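/- **Theorem.** Let $S,A,B$ be germs of holomorphic functions at a point $q_0\in\mathbb C^2$ (coordinates $x,y$), and consider the implicit cubic ODE $$p^3+S(x,y)p^2+A(x,y)p+B(x,y)=0,\qquad p=\frac{dy}{dx}, \qquad (*)$$ whose discriminant $D$ with respect to $p$ does not vanish identically near $q_0$, and for which $(SA-B)(q_0)\neq 0$. At points with $D\ne0$ let $p_1,p_2,p_3$ be local holomorphic branches of the roots, put $$\sigma_1=(p_2-p_3)(dy-p_1dx),\quad \sigma_2=(p_3-p_1)(dy-p_2dx),\quad \sigma_3=(p_1-p_2)(dy-p_3dx),$$ $\Omega=\sigma_1\wedge\sigma_2$, $d\sigma_i=h_i\Omega$, and let $\gamma=h_2\sigma_1-h_1\sigma_2$ be the Chern connection form. For a local nonvanishing solution $K$ of $dK=K\gamma$ put $$v_1=\frac{K(\partial_x+p_1\partial_y)}{(p_3-p_1)(p_1-p_2)},\quad v_2=\frac{K(\partial_x+p_2\partial_y)}{(p_1-p_2)(p_2-p_3)},$$ $$\alpha=\frac{(p_1+p_2)(p_1+p_3)}{(p_1-p_2)(p_1-p_3)},\quad \beta=\frac{(p_2+p_1)(p_2+p_3)}{(p_2-p_1)(p_2-p_3)},\quad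 e_1=\alpha\,\partial_t+v_1,\quad e_2=\beta\,\partial_t+v_2,$$ where $e_1,e_2$ are local vector fields on $\mathbb C^3$ with coordinates $(t,x,y)$. Suppose that near $q_0$ 1. the solution web of $(*)$ admits the infinitesimal symmetry $X=w_xx\partial_x+w_yy\partial_y$, where $w_x\ne w_y$ are complex numbers; 2. $2\gamma=\dfrac{d(SA-B)}{SA-B}$ wherever $D\neq0$; 3. $[e_1,e_2]=0$ wherever $D\ne0$. Then there is a Frobenius $3$-fold germ with $\langle e,e\rangle=1$ whose booklet web is the solution web of $(*)$. More precisely, on a neighbourhood of $(0,q_0)$ in $\mathbb C^3$ there is a structure of Frobenius manifold for which $(t,x,y)$ are flat coordinates with metric $dt^2+2\,dx\,dy$, unity field $e=\partial_t$ and Euler field $E=\frac{w_x+w_y}{2}\,t\,\partial_t+X$. At the points of the surface $\{t=0\}$ (with coordinates $x,y$) near $(0,q_0)$ at which $D\ne 0$ the tangent algebra is semisimple. At all points of the surface near $(0,q_0)$ where the tangent algebra is semisimple, the three directions cut on the surface by the planes spanned by $e$ and the idempotents of the tangent algebra are exactly the directions of the solutions of $(*)$. -/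

import Mathlib

open Filter Topology

noncomputable section

/-! ## Frobenius manifold structures on open subsets of a complex vector space

Germs of Frobenius manifolds are represented by structures on an open set `M` of a complex
normed space `V`; every tangent space is identified with `V`. -/

/-- A Frobenius manifold structure on the open set `M ⊆ V`. All identities are imposed at the
points of `M` only. A connection is written in the chart as
`∇_u v = D v (u) + conn (u, v)`. -/
structure FrobeniusStructure {V : Type*} [NormedAddCommGroup V] [NormedSpace ℂ V]
    (M : Set V) where
  /-- the (complex bilinear) metric -/
  g : V → V →L[ℂ] V →L[ℂ] ℂ
  /-- the multiplication of tangent vectors -/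
  mul : V → V →L[ℂ] V →L[ℂ] V
  /-- the unity vector field -/
  e : V → V
  /-- the Euler vector field -/
  E : V → V
  /-- the Christoffel symbols of the Levi-Civita connection of `g`; they are determined by `g`
  through `conn_symm` and `conn_metric` -/
  conn : V → V →L[ℂ] V →L[ℂ] V
  isOpen : IsOpen M
  g_analytic : AnalyticOnNhd ℂ g M
  mul_analytic : AnalyticOnNhd ℂ mul M
  e_analytic : AnalyticOnNhd ℂ e M
  E_analytic : AnalyticOnNhd ℂ E M
  conn_analytic : AnalyticOnNhd ℂ conn M
  mul_comm : ∀ p ∈ M, ∀ u v, mul p u v = mul p v u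
  mul_assoc : ∀ p ∈ M, ∀ u v w, mul p (mul p u v) w = mul p u (mul p v w)
  g_symm : ∀ p ∈ M, ∀ u v, g p u v = g p v u
  g_nondeg : ∀ p ∈ M, ∀ u, (∀ v, g p u v = 0) → u = 0
  g_invariant : ∀ p ∈ M, ∀ u v w, g p (mul p u v) w = g p u (mul p v w)
  /-- the connection is torsion free -/
  conn_symm : ∀ p ∈ M, ∀ u v, conn p u v = conn p v u
  /-- the connection preserves the metric, `∇ g = 0` -/
  conn_metric : ∀ p ∈ M, ∀ u v w,
    fderiv ℂ g p u v w = g p (conn p u v) w + g p v (conn p u w)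
  /-- the metric is flat: the curvature tensor vanishes -/
  flat : ∀ p ∈ M, ∀ u v w,
    fderiv ℂ conn p u v w - fderiv ℂ conn p v u w
      + conn p u (conn p v w) - conn p v (conn p u w) = 0
  one_mul : ∀ p ∈ M, ∀ v, mul p (e p) v = v
  /-- `∇ e = 0` -/
  e_parallel : ∀ p ∈ M, ∀ u, fderiv ℂ e p u + conn p u (e p) = 0
  /-- `∇ (∇ E) = 0`, where `∇ E` is the field of endomorphisms
  `v ↦ D E (v) + conn (v, E)` -/
  E_linear : ∀ p ∈ M, ∀ u v,
    fderiv ℂ (fun q => fderiv ℂ E q v + conn q v (E q)) p u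
      + conn p u (fderiv ℂ E p v + conn p v (E p))
      - (fderiv ℂ E p (conn p u v) + conn p (conn p u v) (E p)) = 0
  /-- the flow of `E` rescales the metric: `L_E g` is a constant multiple of `g` -/
  E_metric : ∃ d : ℂ, ∀ p ∈ M, ∀ u v,
    fderiv ℂ g p (E p) u v + g p (fderiv ℂ E p u) v + g p u (fderiv ℂ E p v) = d * g p u v
  /-- the flow of `E` rescales the multiplication: its Lie derivative along `E` is a constant
  multiple of it -/
  E_mul : ∃ d : ℂ, ∀ p ∈ M, ∀ u v,
    fderiv ℂ mul p (E p) u v - fderiv ℂ E p (mul p u v)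
      + mul p (fderiv ℂ E p u) v + mul p u (fderiv ℂ E p v) = d • mul p u v
  /-- `(∇_z c)(u, v, w)` is symmetric in all arguments, where `c (u, v, w) = ⟨u · v, w⟩`.
  As `c` is totally symmetric, only the exchange of `z` and `u` has to be required. -/
  potential : ∀ p ∈ M, ∀ z u v w,
    fderiv ℂ (fun q => g q (mul q u v) w) p z
        - g p (mul p (conn p z u) v) w - g p (mul p u (conn p z v)) w
        - g p (mul p u v) (conn p z w)
      = fderiv ℂ (fun q => g q (mul q z v) w) p u
        - g p (mul p (conn p u z) v) w - g p (mul p z (conn p u v)) w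
        - g p (mul p z v) (conn p u w)

namespace FrobeniusStructure

variable {V : Type*} [NormedAddCommGroup V] [NormedSpace ℂ V] {M : Set V}

/-- `ε` is a basis of `T_p M` consisting of three idempotents with `ε i · ε j = δ_ij ε i`. -/
def IsIdempotentFrame (F : FrobeniusStructure M) (p : V) (ε : Fin 3 → V) : Prop :=
  LinearIndependent ℂ ε ∧ Submodule.span ℂ (Set.range ε) = ⊤ ∧
    ∀ i j, F.mul p (ε i) (ε j) = if i = j then ε i else 0

/-- `T_p M` is a semi-simple (three-dimensional) algebra. -/
def IsSemisimpleAt (F : FrobeniusStructure M) (p : V) : Prop :=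
  ∃ ε : Fin 3 → V, F.IsIdempotentFrame p ε

/-- The nonzero tangent vector `u` at the point `z` of the surface parametrized by `φ` is a
direction of the booklet web: it lies in one of the planes spanned by `e` and an idempotent of
the idempotent basis. -/
def IsBookletDirection (F : FrobeniusStructure M) (φ : ℂ × ℂ → V) (z u : ℂ × ℂ) : Prop :=
  u ≠ 0 ∧ ∃ ε : Fin 3 → V, F.IsIdempotentFrame (φ z) ε ∧
    ∃ i, fderiv ℂ φ z u ∈ Submodule.span ℂ {F.e (φ z), ε i}

end FrobeniusStructure

/-! ## Cubic implicit ODEs and their solution webs -/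

/-- The implicit ODE `p³ + S(x,y) p² + A(x,y) p + B(x,y) = 0`, `p = dy/dx`. -/
structure CubicODE where
  S : ℂ × ℂ → ℂ
  A : ℂ × ℂ → ℂ
  B : ℂ × ℂ → ℂ

namespace CubicODE

/-- The binary form `dy³ + S dy² dx + A dy dx² + B dx³` at the point `z` on the vector `u`.
Its zeros `u ≠ 0` are the directions of the solutions through `z`. -/
def form (W : CubicODE) (z u : ℂ × ℂ) : ℂ :=
  u.2 ^ 3 + W.S z * u.2 ^ 2 * u.1 + W.A z * u.2 * u.1 ^ 2 + W.B z * u.1 ^ 3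

/-- The discriminant with respect to `p`. -/
def discr (W : CubicODE) (z : ℂ × ℂ) : ℂ :=
  18 * W.S z * W.A z * W.B z + W.S z ^ 2 * W.A z ^ 2 - 4 * W.A z ^ 3 - 27 * W.B z ^ 2
    - 4 * W.B z * W.S z ^ 3

/-- The function `S A - B`. -/
def saSubB (W : CubicODE) (z : ℂ × ℂ) : ℂ := W.S z * W.A z - W.B z

/-- The vector field `X` is an infinitesimal symmetry of the solution web near `q₀`: the Lie
derivative of the binary form along `X` is proportional to the form. -/
def IsInfinitesimalSymmetry (W : CubicODE) (X : ℂ × ℂ → ℂ × ℂ) (q₀ : ℂ × ℂ) : Prop :=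
  ∃ c : ℂ × ℂ → ℂ, ∀ᶠ z in 𝓝 q₀, ∀ u : ℂ × ℂ,
    fderiv ℂ (fun r : (ℂ × ℂ) × (ℂ × ℂ) => W.form r.1 r.2) (z, u) (X z, fderiv ℂ X z u)
      = c z * W.form z u

/-- `p 0, p 1, p 2` are analytic branches near `z` of the three roots of the cubic. -/
def IsRootBranches (W : CubicODE) (p : Fin 3 → ℂ × ℂ → ℂ) (z : ℂ × ℂ) : Prop :=
  (∀ i, AnalyticAt ℂ (p i) z) ∧
    ∀ᶠ w in 𝓝 z, ∀ s : ℂ,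
      s ^ 3 + W.S w * s ^ 2 + W.A w * s + W.B w = (s - p 0 w) * (s - p 1 w) * (s - p 2 w)

/-- The solution web of `W` is the booklet web cut on the surface `φ` by the Frobenius structure
`F`, near `q₀`: `φ` parametrizes a surface transverse to `e`, the tangent algebra is
semi-simple at the points of the surface off the discriminant curve, and wherever it is
semi-simple the booklet directions are those of the solutions. -/
def IsBookletWeb (W : CubicODE) {V : Type*} [NormedAddCommGroup V] [NormedSpace ℂ V] {M : Set V}
    (F : FrobeniusStructure M) (φ : ℂ × ℂ → V) (q₀ : ℂ × ℂ) : Prop :=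
  AnalyticAt ℂ φ q₀ ∧ φ q₀ ∈ M ∧
    ∀ᶠ z in 𝓝 q₀,
      (Function.Injective (fderiv ℂ φ z) ∧ F.e (φ z) ∉ Set.range (fderiv ℂ φ z)) ∧
      (W.discr z ≠ 0 → F.IsSemisimpleAt (φ z)) ∧
      (F.IsSemisimpleAt (φ z) → ∀ u : ℂ × ℂ, u ≠ 0 →
        (F.IsBookletDirection φ z u ↔ W.form z u = 0))

end CubicODE

/-! ## Chern connection and the fields `e₁, e₂, e₃`

Indices `1, 2, 3` are `0, 1, 2 : Fin 3`; `i + 1`, `i + 2` are cyclic. -/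

namespace RootBranches

/-- The 1-form `dx`. -/
def dx : ℂ × ℂ →L[ℂ] ℂ := ContinuousLinearMap.fst ℂ ℂ ℂ

/-- The 1-form `dy`. -/
def dy : ℂ × ℂ →L[ℂ] ℂ := ContinuousLinearMap.snd ℂ ℂ ℂ

/-- `dω` on the pair `(∂x, ∂y)`. -/
def extD (ω : ℂ × ℂ → (ℂ × ℂ →L[ℂ] ℂ)) (z : ℂ × ℂ) : ℂ :=
  fderiv ℂ ω z (1, 0) (0, 1) - fderiv ℂ ω z (0, 1) (1, 0)

/-- `ω ∧ η` on the pair `(∂x, ∂y)`. -/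
def wedge (ω η : ℂ × ℂ →L[ℂ] ℂ) : ℂ := ω (1, 0) * η (0, 1) - ω (0, 1) * η (1, 0)

/-- `σ₁ = (p₂ - p₃)(dy - p₁ dx)`, and cyclically. -/
def sigma (p : Fin 3 → ℂ × ℂ → ℂ) (i : Fin 3) (z : ℂ × ℂ) : ℂ × ℂ →L[ℂ] ℂ :=
  (p (i + 1) z - p (i + 2) z) • (dy - p i z • dx)

/-- `h i`, defined by `dσᵢ = hᵢ Ω` with `Ω = σ₁ ∧ σ₂`. -/
def h (p : Fin 3 → ℂ × ℂ → ℂ) (i : Fin 3) (z : ℂ × ℂ) : ℂ :=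
  extD (sigma p i) z / wedge (sigma p 0 z) (sigma p 1 z)

/-- The Chern connection form `γ = h₂ σ₁ - h₁ σ₂`. -/
def chernForm (p : Fin 3 → ℂ × ℂ → ℂ) (z : ℂ × ℂ) : ℂ × ℂ →L[ℂ] ℂ :=
  h p 1 z • sigma p 0 z - h p 0 z • sigma p 1 z

/-- `K` is a nonvanishing analytic solution of `dK = K γ` near `z`. -/
def IsIntegratingFactor (p : Fin 3 → ℂ × ℂ → ℂ) (K : ℂ × ℂ → ℂ) (z : ℂ × ℂ) : Prop :=
  AnalyticAt ℂ K z ∧ K z ≠ 0 ∧ ∀ᶠ w in 𝓝 z, fderiv ℂ K w = K w • chernForm p w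

/-- `v₁ = K (∂x + p₁ ∂y) / ((p₃ - p₁)(p₁ - p₂))`, and cyclically. -/
def webField (p : Fin 3 → ℂ × ℂ → ℂ) (K : ℂ × ℂ → ℂ) (i : Fin 3) (z : ℂ × ℂ) : ℂ × ℂ :=
  (K z / ((p (i + 2) z - p i z) * (p i z - p (i + 1) z))) • ((1 : ℂ), p i z)

/-- `α = (p₁ + p₂)(p₁ + p₃) / ((p₁ - p₂)(p₁ - p₃))` for `i = 0`,
`β = (p₂ + p₁)(p₂ + p₃) / ((p₂ - p₁)(p₂ - p₃))` for `i = 1`. -/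
def coeff (p : Fin 3 → ℂ × ℂ → ℂ) (i : Fin 3) (z : ℂ × ℂ) : ℂ :=
  ((p i z + p (i + 1) z) * (p i z + p (i + 2) z)) /
    ((p i z - p (i + 1) z) * (p i z - p (i + 2) z))

/-- `e₁ = α ∂t + v₁` for `i = 0`, `e₂ = β ∂t + v₂` for `i = 1`, vector fields on `ℂ³` with
coordinates `(t, (x, y))`. -/
def idemField (p : Fin 3 → ℂ × ℂ → ℂ) (K : ℂ × ℂ → ℂ) (i : Fin 3) (q : ℂ × ℂ × ℂ) :
    ℂ × ℂ × ℂ :=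
  (coeff p i q.2, webField p K i q.2)

end RootBranches

/-- The vector field `X = w_x x ∂x + w_y y ∂y`. -/
def dilatation (wx wy : ℂ) (z : ℂ × ℂ) : ℂ × ℂ := (wx * z.1, wy * z.2)

end

/-! In flat coordinates with metric dt² + 2dx dy and unity ∂t, a commutative invariant
multiplication independent of t is given by four functions P, Q, R, T of (x, y). A vector u = x∂x +
y∂y lies in a plane spanned by ∂t and an idempotent exactly when u² lies in span(∂t, u), that is,
when Ty³ + Rxy² - Qx²y - Px³ = 0. Matching this with the cubic forces (P, Q, R, T) = (-B, -A, S,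
1)/κ, and associativity PT - QR = 1 forces κ² = SA - B. So the algebra is known up to the sign of κ,
and it is analytic because SA - B does not vanish at q₀.

Two properties remain. Potentiality is P_y = Q_x, Q_y = R_x, R_y = T_x. Where D ≠ 0 there are
analytic roots; the Chern condition says dκ = κγ, and together with the ∂t-component of [e₁, e₂] = 0
it gives linear equations in the derivatives of the roots which imply the three equations
(`potentiality_of_commuting`). These involve only S, A, B, κ, so they extend over D = 0 by
continuity (`AnalyticOnNhd.eq_zero_of_forall_ne_zero`). The Euler field comes from the symmetry,
which makes S, A, B, κ homogeneous of weights 1, 2, 3, 3/2 in units of w_y - w_x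
(`homogeneous_of_symmetry`). -/

/-! ### Analytic branches of the roots of a cubic. -/

/-- A monic complex cubic has three roots. -/
theorem exists_three_roots (S A B : ℂ) :
    ∃ x y z : ℂ, S = -(x + y + z) ∧ A = x * y + x * z + y * z ∧ B = -(x * y * z) := by
  have ha : (⟨1, S, A, B⟩ : Cubic ℂ).a ≠ 0 := one_ne_zero
  obtain ⟨x, y, z, h3⟩ :=
    (Cubic.splits_iff_roots_eq_three (φ := RingHom.id ℂ) ha).1 (IsAlgClosed.splits _)
  have hb := Cubic.b_eq_three_roots ha h3
  have hc := Cubic.c_eq_three_roots ha h3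
  have hd := Cubic.d_eq_three_roots ha h3
  simp only [RingHom.id_apply, one_mul] at hb hc hd
  exact ⟨x, y, z, hb, hc, hd⟩

/-- The coefficients of the monic cubic with the given roots. -/
def cubicCoeffs (r : ℂ × ℂ × ℂ) : ℂ × ℂ × ℂ :=
  (-(r.1 + r.2.1 + r.2.2), r.1 * r.2.1 + r.1 * r.2.2 + r.2.1 * r.2.2, -(r.1 * r.2.1 * r.2.2))

theorem analyticAt_cubicCoeffs (r : ℂ × ℂ × ℂ) : AnalyticAt ℂ cubicCoeffs r := by
  have h1 : AnalyticAt ℂ (fun r : ℂ × ℂ × ℂ => r.1) r := analyticAt_fst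
  have h2 : AnalyticAt ℂ (fun r : ℂ × ℂ × ℂ => r.2.1) r := analyticAt_fst.fun_comp analyticAt_snd
  have h3 : AnalyticAt ℂ (fun r : ℂ × ℂ × ℂ => r.2.2) r := analyticAt_snd.fun_comp analyticAt_snd
  exact ((h1.add h2).add h3).neg.prod
    ((((h1.mul h2).add (h1.mul h3)).add (h2.mul h3)).prod ((h1.mul h2).mul h3).neg)

theorem fderiv_cubicCoeffs_apply (r v : ℂ × ℂ × ℂ) :
    fderiv ℂ cubicCoeffs r v = (-(v.1 + v.2.1 + v.2.2),
      v.1 * (r.2.1 + r.2.2) + v.2.1 * (r.1 + r.2.2) + v.2.2 * (r.1 + r.2.1),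
      -(v.1 * r.2.1 * r.2.2 + v.2.1 * r.1 * r.2.2 + v.2.2 * r.1 * r.2.1)) := by
  have h1 : HasFDerivAt (fun r : ℂ × ℂ × ℂ => r.1) (ContinuousLinearMap.fst ℂ ℂ (ℂ × ℂ)) r :=
    hasFDerivAt_fst
  have h2 : HasFDerivAt (fun r : ℂ × ℂ × ℂ => r.2.1)
      ((ContinuousLinearMap.fst ℂ ℂ ℂ).comp (ContinuousLinearMap.snd ℂ ℂ (ℂ × ℂ))) r :=
    hasFDerivAt_fst.comp r hasFDerivAt_snd
  have h3 : HasFDerivAt (fun r : ℂ × ℂ × ℂ => r.2.2)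
      ((ContinuousLinearMap.snd ℂ ℂ ℂ).comp (ContinuousLinearMap.snd ℂ ℂ (ℂ × ℂ))) r :=
    hasFDerivAt_snd.comp r hasFDerivAt_snd
  have h := ((h1.add h2).add h3).neg.prodMk
    ((((h1.mul h2).add (h1.mul h3)).add (h2.mul h3)).prodMk ((h1.mul h2).mul h3).neg)
  have h' := HasFDerivAt.fderiv (f := cubicCoeffs) h
  rw [h']
  simp only [ContinuousLinearMap.prod_apply, neg_apply,
    add_apply, smul_apply, smul_eq_mul,
    ContinuousLinearMap.coe_fst', ContinuousLinearMap.coe_snd', ContinuousLinearMap.comp_apply,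
    Prod.mk.injEq, Pi.mul_apply]
  refine ⟨trivial, ?_, ?_⟩ <;> ring

theorem injective_fderiv_cubicCoeffs {r : ℂ × ℂ × ℂ} (h01 : r.1 ≠ r.2.1) (h02 : r.1 ≠ r.2.2)
    (h12 : r.2.1 ≠ r.2.2) : Function.Injective (fderiv ℂ cubicCoeffs r) := by
  rw [injective_iff_map_eq_zero]
  rintro ⟨a, b, c⟩ h
  rw [fderiv_cubicCoeffs_apply] at h
  obtain ⟨x, y, z⟩ := r
  simp only [Prod.mk_eq_zero, ne_eq] at h h01 h02 h12 ⊢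
  obtain ⟨h1, h2, h3⟩ := h
  -- The first-order variation of the polynomial vanishes for a kernel vector; its value at the root
  -- x is -a(x - y)(x - z), and similarly at y and z.
  have ha : a * ((x - y) * (x - z)) = 0 := by linear_combination -x ^ 2 * h1 - x * h2 - h3
  have hb : b * ((y - x) * (y - z)) = 0 := by linear_combination -y ^ 2 * h1 - y * h2 - h3
  have hc : c * ((z - x) * (z - y)) = 0 := by linear_combination -z ^ 2 * h1 - z * h2 - h3
  simpa [sub_eq_zero, h01, h02, h12, Ne.symm h01, Ne.symm h02, Ne.symm h12,
    eq_comm (a := y) (b := x), eq_comm (a := z)] using And.intro ha (And.intro hb hc)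

namespace CubicODE

variable {W : CubicODE}

/-- Analytic branches of the roots exist off the discriminant curve. -/
theorem exists_isRootBranches {z : ℂ × ℂ} (hS : AnalyticAt ℂ W.S z) (hA : AnalyticAt ℂ W.A z)
    (hB : AnalyticAt ℂ W.B z) (hD : W.discr z ≠ 0) : ∃ p, W.IsRootBranches p z := by
  obtain ⟨a, b, c, h1, h2, h3⟩ := exists_three_roots (W.S z) (W.A z) (W.B z)
  have hV : W.discr z = ((a - b) * (a - c) * (b - c)) ^ 2 := by
    rw [discr, h1, h2, h3]; ring
  have hV' : (a - b) * (a - c) * (b - c) ≠ 0 := fun h => hD (by rw [hV, h]; ring)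
  simp only [mul_ne_zero_iff, sub_ne_zero] at hV'
  obtain ⟨⟨hab, hac⟩, hbc⟩ := hV'
  set r : ℂ × ℂ × ℂ := (a, b, c)
  have hinj := injective_fderiv_cubicCoeffs (r := r) hab hac hbc
  let i : (ℂ × ℂ × ℂ) ≃L[ℂ] (ℂ × ℂ × ℂ) :=
    (LinearEquiv.ofInjectiveEndo (fderiv ℂ cubicCoeffs r : (ℂ × ℂ × ℂ) →ₗ[ℂ] _)
      hinj).toContinuousLinearEquiv
  have hi : fderiv ℂ cubicCoeffs r = i := by ext <;> rfl
  -- The branches are the analytic local inverse of the map from roots to coefficients, evaluated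
  -- along (S, A, B).
  have hst : HasStrictFDerivAt cubicCoeffs (i : (ℂ × ℂ × ℂ) →L[ℂ] _) r := by
    rw [← hi]; exact (analyticAt_cubicCoeffs r).hasStrictFDerivAt
  have han : AnalyticAt ℂ (hst.localInverse cubicCoeffs i r) (cubicCoeffs r) :=
    (hst.toOpenPartialHomeomorph cubicCoeffs).analyticAt_symm'
      hst.mem_toOpenPartialHomeomorph_source (analyticAt_cubicCoeffs r) hi
  have hz : (W.S z, W.A z, W.B z) = cubicCoeffs r := by
    simp [cubicCoeffs, h1, h2, h3, r]
  have hco : AnalyticAt ℂ (fun w => (W.S w, W.A w, W.B w)) z := hS.prod (hA.prod hB)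
  have hG : AnalyticAt ℂ
      (fun w => hst.localInverse cubicCoeffs i r (W.S w, W.A w, W.B w)) z :=
    AnalyticAt.fun_comp (by rw [hz]; exact han) hco
  have hri := hst.eventually_right_inverse
  rw [← hz] at hri
  have hri' := hco.continuousAt.eventually hri
  set G := fun w => hst.localInverse cubicCoeffs i r (W.S w, W.A w, W.B w)
  refine ⟨![fun w => (G w).1, fun w => (G w).2.1, fun w => (G w).2.2], ?_, ?_⟩
  · intro j
    fin_cases j
    · exact analyticAt_fst.fun_comp hG
    · exact analyticAt_fst.fun_comp (analyticAt_snd.fun_comp hG)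
    · exact analyticAt_snd.fun_comp (analyticAt_snd.fun_comp hG)
  · filter_upwards [hri'] with w hw s
    have hw' : cubicCoeffs (G w) = (W.S w, W.A w, W.B w) := hw
    simp only [cubicCoeffs, Prod.mk.injEq] at hw'
    obtain ⟨e1, e2, e3⟩ := hw'
    simp only [Matrix.cons_val]
    rw [← e1, ← e2, ← e3]; ring

/-- Vieta's formulas. -/
theorem IsRootBranches.eventually_vieta {p : Fin 3 → ℂ × ℂ → ℂ} {z : ℂ × ℂ}
    (h : W.IsRootBranches p z) : ∀ᶠ w in 𝓝 z, W.S w = -(p 0 w + p 1 w + p 2 w) ∧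
      W.A w = p 0 w * p 1 w + p 0 w * p 2 w + p 1 w * p 2 w ∧
      W.B w = -(p 0 w * p 1 w * p 2 w) := by
  filter_upwards [h.2] with w hw
  have h0 := hw 0
  have h1 := hw 1
  have h2 := hw (-1)
  refine ⟨?_, ?_, ?_⟩
  · linear_combination (h1 + h2) / 2 - h0
  · linear_combination (h1 - h2) / 2
  · linear_combination h0

theorem IsRootBranches.eventually {p : Fin 3 → ℂ × ℂ → ℂ} {z : ℂ × ℂ}
    (h : W.IsRootBranches p z) : ∀ᶠ w in 𝓝 z, W.IsRootBranches p w := by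
  filter_upwards [(h.1 0).eventually_analyticAt, (h.1 1).eventually_analyticAt,
    (h.1 2).eventually_analyticAt, h.2.eventually_nhds] with w h0 h1 h2 h3
  refine ⟨fun i => ?_, h3⟩
  fin_cases i
  exacts [h0, h1, h2]

end CubicODE

/-! ### Potentiality as linear algebra in the derivatives of the roots. -/

/-- The linear system satisfied by the derivatives `aᵢ = ∂x pᵢ`, `bᵢ = ∂y pᵢ` of the roots:
`hk` says that `(Gx, Gy) = d (SA - B) / (2 (SA - B))`, `hγ` that this is the Chern form and
`hc` that the two idempotent fields commute. -/
theorem potentiality_of_commuting {p0 p1 p2 a0 a1 a2 b0 b1 b2 Gx Gy S A B Sx Sy Ax Ay Bx By : ℂ}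
    (hS : S = -(p0 + p1 + p2)) (hA : A = p0 * p1 + p0 * p2 + p1 * p2)
    (hB : B = -(p0 * p1 * p2))
    (hSx : Sx = -(a0 + a1 + a2)) (hSy : Sy = -(b0 + b1 + b2))
    (hAx : Ax = a0 * (p1 + p2) + a1 * (p0 + p2) + a2 * (p0 + p1))
    (hAy : Ay = b0 * (p1 + p2) + b1 * (p0 + p2) + b2 * (p0 + p1))
    (hBx : Bx = -(a0 * p1 * p2 + a1 * p0 * p2 + a2 * p0 * p1))
    (hBy : By = -(b0 * p1 * p2 + b1 * p0 * p2 + b2 * p0 * p1))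
    (h01 : p0 - p1 ≠ 0) (h12 : p1 - p2 ≠ 0) (h20 : p2 - p0 ≠ 0) (hk : S * A - B ≠ 0)
    (hkx : 2 * (S * A - B) * Gx = Sx * A + S * Ax - Bx)
    (hky : 2 * (S * A - B) * Gy = Sy * A + S * Ay - By)
    (hγx : (p1 - p2) * (p2 - p0) * (p1 - p0) * Gx =
      -((a2 - a0) + ((b2 - b0) * p1 + (p2 - p0) * b1)) * ((p1 - p2) * p0)
        + ((a1 - a2) + ((b1 - b2) * p0 + (p1 - p2) * b0)) * ((p2 - p0) * p1))
    (hγy : (p1 - p2) * (p2 - p0) * (p1 - p0) * Gy =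
      ((a2 - a0) + ((b2 - b0) * p1 + (p2 - p0) * b1)) * (p1 - p2)
        - ((a1 - a2) + ((b1 - b2) * p0 + (p1 - p2) * b0)) * (p2 - p0))
    (hc : (p2 - p0) *
        ((((a1 + p0 * b1) + (a2 + p0 * b2)) * (p1 + p0)
            + (p1 + p2) * ((a1 + p0 * b1) + (a0 + p0 * b0))) * ((p1 - p2) * (p1 - p0))
          - (p1 + p2) * (p1 + p0) * (((a1 + p0 * b1) - (a2 + p0 * b2)) * (p1 - p0)
            + (p1 - p2) * ((a1 + p0 * b1) - (a0 + p0 * b0)))) =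
      (p1 - p2) *
        ((((a0 + p1 * b0) + (a1 + p1 * b1)) * (p0 + p2)
            + (p0 + p1) * ((a0 + p1 * b0) + (a2 + p1 * b2))) * ((p0 - p1) * (p0 - p2))
          - (p0 + p1) * (p0 + p2) * (((a0 + p1 * b0) - (a1 + p1 * b1)) * (p0 - p2)
            + (p0 - p1) * ((a0 + p1 * b0) - (a2 + p1 * b2))))) :
    -By + B * Gy + Ax - A * Gx = 0 ∧ -Ay + A * Gy - Sx + S * Gx = 0 ∧ Sy - S * Gy + Gx = 0 := by
  -- Hypotheses and conclusions are linear and homogeneous in the eight quantities aᵢ, bᵢ, Gx, Gy.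
  -- Each conclusion times this nonzero factor is a combination of the hypotheses with coefficients
  -- polynomial in the roots; `norm := skip` delays normalization until Vieta's formulas are
  -- substituted.
  have hV : (S * A - B) * ((p0 - p1) * ((p0 - p1) * (p1 - p2) * (p2 - p0))) ≠ 0 := by
    positivity
  refine ⟨?_, ?_, ?_⟩ <;> refine (mul_eq_zero_iff_left hV).1 ?_
  · linear_combination (norm := skip) (p0 - p1) * (-A * (S * A - B) * hγx - 3 * B * (S * A - B) * hγy
      - ((p0 - p1) * (p1 - p2) * (p2 - p0)) * (A * hkx + B * hky)) + (A ^ 2 + S * B) * hc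
    subst hS hA hB hSx hSy hAx hAy hBx hBy
    ring
  · linear_combination (norm := skip) (p0 - p1) * (-S * (S * A - B) * hγx - A * (S * A - B) * hγy)
      + 3 / 2 * (S * A - B) * hc
    subst hS hA hB hSx hSy hAx hAy hBx hBy
    ring
  · linear_combination (norm := skip) (p0 - p1) * (-3 * (S * A - B) * hγx - S * (S * A - B) * hγy
      - ((p0 - p1) * (p1 - p2) * (p2 - p0)) * (hkx + S * hky)) + (S ^ 2 + A) * hc
    subst hS hA hB hSx hSy hAx hAy hBx hBy
    ring

/-! ### Derivatives of the Chern form and of the fields e₁, e₂. -/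

namespace RootBranches

variable {p : Fin 3 → ℂ × ℂ → ℂ} {K : ℂ × ℂ → ℂ} {z : ℂ × ℂ}

theorem extD_sigma (hp : ∀ i, DifferentiableAt ℂ (p i) z) (i : Fin 3) :
    extD (sigma p i) z =
      (fderiv ℂ (p (i + 1)) z (1, 0) - fderiv ℂ (p (i + 2)) z (1, 0))
        + ((fderiv ℂ (p (i + 1)) z (0, 1) - fderiv ℂ (p (i + 2)) z (0, 1)) * p i z
          + (p (i + 1) z - p (i + 2) z) * fderiv ℂ (p i) z (0, 1)) := by
  have h := ((hp (i + 1)).hasFDerivAt.fun_sub (hp (i + 2)).hasFDerivAt).fun_smul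
    ((hasFDerivAt_const dy z).fun_sub ((hp i).hasFDerivAt.fun_smul (hasFDerivAt_const dx z)))
  have h' : fderiv ℂ (sigma p i) z = _ := h.fderiv
  rw [extD, h']
  simp [dx, dy]
  ring

theorem sigma_apply_fst (i : Fin 3) :
    sigma p i z (1, 0) = -((p (i + 1) z - p (i + 2) z) * p i z) := by
  simp [sigma, dx, dy]

theorem sigma_apply_snd (i : Fin 3) :
    sigma p i z (0, 1) = p (i + 1) z - p (i + 2) z := by
  simp [sigma, dx, dy]

theorem wedge_sigma :
    wedge (sigma p 0 z) (sigma p 1 z) =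
      (p 1 z - p 2 z) * (p 2 z - p 0 z) * (p 1 z - p 0 z) := by
  simp only [wedge, sigma_apply_fst, sigma_apply_snd]
  simp
  ring

theorem wedge_mul_chernForm_apply (hw : wedge (sigma p 0 z) (sigma p 1 z) ≠ 0) (v : ℂ × ℂ) :
    wedge (sigma p 0 z) (sigma p 1 z) * chernForm p z v =
      extD (sigma p 1) z * sigma p 0 z v - extD (sigma p 0) z * sigma p 1 z v := by
  simp only [chernForm, h, sub_apply, smul_apply, smul_eq_mul]
  field_simp

/-- The quotient rule cleared of denominators, so that the commutation condition becomes polynomial.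
-/
theorem fderiv_coeff_mul (hp : ∀ i, DifferentiableAt ℂ (p i) z) (i : Fin 3)
    (h1 : p i z - p (i + 1) z ≠ 0) (h2 : p i z - p (i + 2) z ≠ 0) (v : ℂ × ℂ) :
    DifferentiableAt ℂ (coeff p i) z ∧
    fderiv ℂ (coeff p i) z v * ((p i z - p (i + 1) z) * (p i z - p (i + 2) z)) ^ 2 =
      ((fderiv ℂ (p i) z v + fderiv ℂ (p (i + 1)) z v) * (p i z + p (i + 2) z)
          + (p i z + p (i + 1) z) * (fderiv ℂ (p i) z v + fderiv ℂ (p (i + 2)) z v))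
          * ((p i z - p (i + 1) z) * (p i z - p (i + 2) z))
        - (p i z + p (i + 1) z) * (p i z + p (i + 2) z)
          * ((fderiv ℂ (p i) z v - fderiv ℂ (p (i + 1)) z v) * (p i z - p (i + 2) z)
            + (p i z - p (i + 1) z) * (fderiv ℂ (p i) z v - fderiv ℂ (p (i + 2)) z v)) := by
  have d0 := (hp i).hasFDerivAt
  have d1 := (hp (i + 1)).hasFDerivAt
  have d2 := (hp (i + 2)).hasFDerivAt
  have hd := ((d0.fun_add d1).fun_mul (d0.fun_add d2)).fun_mul
    ((hasDerivAt_inv (mul_ne_zero h1 h2)).comp_hasFDerivAt z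
      ((d0.fun_sub d1).fun_mul (d0.fun_sub d2)))
  have hd' : HasFDerivAt (coeff p i) _ z := hd
  refine ⟨hd'.differentiableAt, ?_⟩
  rw [hd'.fderiv]
  simp
  field_simp
  ring

/-- Nothing depends on t, so the ∂t-component of the bracket is v₁(β) - v₂(α) when i = 0 and j = 1.
-/
theorem lieBracket_idemField_fst {i j : Fin 3} (hi : DifferentiableAt ℂ (coeff p i) z)
    (hj : DifferentiableAt ℂ (coeff p j) z) (hi' : DifferentiableAt ℂ (webField p K i) z)
    (hj' : DifferentiableAt ℂ (webField p K j) z) (t : ℂ) :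
    (VectorField.lieBracket ℂ (idemField p K i) (idemField p K j) (t, z)).1 =
      fderiv ℂ (coeff p j) z (webField p K i z) - fderiv ℂ (coeff p i) z (webField p K j z) := by
  have key : ∀ k : Fin 3, DifferentiableAt ℂ (coeff p k) z → DifferentiableAt ℂ (webField p K k) z →
      ∀ v, (fderiv ℂ (idemField p K k) (t, z) v).1 = fderiv ℂ (coeff p k) z v.2 := by
    intro k h1 h2 v
    have hs : HasFDerivAt (fun q : ℂ × ℂ × ℂ => q.2) (ContinuousLinearMap.snd ℂ ℂ (ℂ × ℂ)) (t, z) :=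
      hasFDerivAt_snd
    have h := (HasFDerivAt.comp (t, z) (g := coeff p k) h1.hasFDerivAt hs).prodMk
      (HasFDerivAt.comp (t, z) (g := webField p K k) h2.hasFDerivAt hs)
    have h' : HasFDerivAt (idemField p K k) _ (t, z) := h
    rw [h'.fderiv]
    simp
  rw [VectorField.lieBracket, Prod.fst_sub, key j hj hj', key i hi hi']
  rfl

theorem differentiableAt_webField (hp : ∀ i, DifferentiableAt ℂ (p i) z)
    (hK : DifferentiableAt ℂ K z) (i : Fin 3) (h1 : p i z - p (i + 1) z ≠ 0)
    (h2 : p (i + 2) z - p i z ≠ 0) : DifferentiableAt ℂ (webField p K i) z := by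
  have d0 := hp i
  have d1 := hp (i + 1)
  have d2 := hp (i + 2)
  have h := (hK.fun_mul (((d2.fun_sub d0).fun_mul (d0.fun_sub d1)).fun_inv
    (mul_ne_zero h2 h1))).fun_smul ((differentiableAt_const (1 : ℂ)).prodMk d0)
  exact h

end RootBranches

theorem Complex.fderiv_apply_one_mk (s : ℂ) {f : ℂ × ℂ → ℂ} {z : ℂ × ℂ} :
    fderiv ℂ f z (1, s) = fderiv ℂ f z (1, 0) + s * fderiv ℂ f z (0, 1) := by
  rw [← smul_eq_mul, ← map_smul, ← map_add]
  simp

/-! ### Potentiality off the discriminant curve. -/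

namespace CubicODE

variable {W : CubicODE}

/-- A square root of `SA - B` is an integrating factor of the Chern connection. -/
theorem IsRootBranches.isIntegratingFactor {p : Fin 3 → ℂ × ℂ → ℂ} {z : ℂ × ℂ} {κ : ℂ × ℂ → ℂ}
    (hp : W.IsRootBranches p z) (hκ : AnalyticAt ℂ κ z) (hκ0 : κ z ≠ 0)
    (hκ2 : ∀ᶠ w in 𝓝 z, κ w ^ 2 = W.saSubB w)
    (hchern : ∀ᶠ w in 𝓝 z, ∀ p : Fin 3 → ℂ × ℂ → ℂ, W.IsRootBranches p w →
      (2 : ℂ) • RootBranches.chernForm p w = (W.saSubB w)⁻¹ • fderiv ℂ W.saSubB w) :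
    RootBranches.IsIntegratingFactor p κ z := by
  refine ⟨hκ, hκ0, ?_⟩
  filter_upwards [hp.eventually, hchern, hκ2.eventually_nhds, hκ.eventually_analyticAt,
    hκ.continuousAt.eventually_ne hκ0] with w hpw hcw hw han h0
  have h1 := hcw p hpw
  -- From κ² = SA - B, the condition 2γ = d(κ²)/κ² reads γ = dκ/κ.
  have h2 : fderiv ℂ W.saSubB w = (2 * κ w) • fderiv ℂ κ w := by
    have hd : HasFDerivAt (fun w => κ w ^ 2) _ w := han.differentiableAt.hasFDerivAt.pow 2
    rw [(hd.congr_of_eventuallyEq (hw.mono fun _ h => h.symm)).fderiv]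
    simp
  rw [h2, ← hw.self_of_nhds] at h1
  refine ContinuousLinearMap.ext fun v => ?_
  have h3 := congrArg (fun L : ℂ × ℂ →L[ℂ] ℂ => L v) h1
  simp only [smul_apply, smul_eq_mul] at h3 ⊢
  field_simp at h3
  linear_combination -h3

theorem IsRootBranches.fderiv_vieta {p : Fin 3 → ℂ × ℂ → ℂ} {z : ℂ × ℂ}
    (h : W.IsRootBranches p z) (v : ℂ × ℂ) :
    fderiv ℂ W.S z v = -(fderiv ℂ (p 0) z v + fderiv ℂ (p 1) z v + fderiv ℂ (p 2) z v) ∧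
    fderiv ℂ W.A z v = fderiv ℂ (p 0) z v * (p 1 z + p 2 z)
      + fderiv ℂ (p 1) z v * (p 0 z + p 2 z) + fderiv ℂ (p 2) z v * (p 0 z + p 1 z) ∧
    fderiv ℂ W.B z v = -(fderiv ℂ (p 0) z v * p 1 z * p 2 z
      + fderiv ℂ (p 1) z v * p 0 z * p 2 z + fderiv ℂ (p 2) z v * p 0 z * p 1 z) := by
  have d0 := (h.1 0).differentiableAt.hasFDerivAt
  have d1 := (h.1 1).differentiableAt.hasFDerivAt
  have d2 := (h.1 2).differentiableAt.hasFDerivAt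
  have hv := h.eventually_vieta
  have eS : W.S =ᶠ[𝓝 z] _ := hv.mono fun w hw => hw.1
  have eA : W.A =ᶠ[𝓝 z] _ := hv.mono fun w hw => hw.2.1
  have eB : W.B =ᶠ[𝓝 z] _ := hv.mono fun w hw => hw.2.2
  rw [eS.fderiv_eq, eA.fderiv_eq, eB.fderiv_eq, ((d0.fun_add d1).fun_add d2).fun_neg.fderiv,
    (((d0.fun_mul d1).fun_add (d0.fun_mul d2)).fun_add (d1.fun_mul d2)).fderiv,
    ((d0.fun_mul d1).fun_mul d2).fun_neg.fderiv]
  refine ⟨?_, ?_, ?_⟩ <;> simp <;> ring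

theorem fderiv_saSubB {z : ℂ × ℂ} (hS : DifferentiableAt ℂ W.S z) (hA : DifferentiableAt ℂ W.A z)
    (hB : DifferentiableAt ℂ W.B z) (v : ℂ × ℂ) :
    fderiv ℂ W.saSubB z v =
      fderiv ℂ W.S z v * W.A z + W.S z * fderiv ℂ W.A z v - fderiv ℂ W.B z v := by
  have h : HasFDerivAt W.saSubB _ z :=
    (hS.hasFDerivAt.fun_mul hA.hasFDerivAt).fun_sub hB.hasFDerivAt
  rw [h.fderiv]
  simp
  ring

theorem IsRootBranches.sub_ne_zero {p : Fin 3 → ℂ × ℂ → ℂ} {z : ℂ × ℂ}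
    (h : W.IsRootBranches p z) (hD : W.discr z ≠ 0) :
    p 0 z - p 1 z ≠ 0 ∧ p 1 z - p 2 z ≠ 0 ∧ p 2 z - p 0 z ≠ 0 := by
  obtain ⟨h1, h2, h3⟩ := h.eventually_vieta.self_of_nhds
  have hV : W.discr z = ((p 0 z - p 1 z) * (p 1 z - p 2 z) * (p 2 z - p 0 z)) ^ 2 := by
    rw [discr, h1, h2, h3]; ring
  refine ⟨?_, ?_, ?_⟩ <;> intro h0 <;> exact hD (by rw [hV, h0]; ring)

/-- Off the discriminant curve the structure constants built from the cubic satisfy the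
equations of potentiality. -/
theorem potentiality_of_discr_ne_zero {z : ℂ × ℂ} {κ : ℂ × ℂ → ℂ}
    (hS : AnalyticAt ℂ W.S z) (hA : AnalyticAt ℂ W.A z) (hB : AnalyticAt ℂ W.B z)
    (hD : W.discr z ≠ 0) (hκ : AnalyticAt ℂ κ z) (hκ0 : κ z ≠ 0)
    (hκ2 : ∀ᶠ w in 𝓝 z, κ w ^ 2 = W.saSubB w)
    (hchern : ∀ᶠ w in 𝓝 z, ∀ p : Fin 3 → ℂ × ℂ → ℂ, W.IsRootBranches p w →
      (2 : ℂ) • RootBranches.chernForm p w = (W.saSubB w)⁻¹ • fderiv ℂ W.saSubB w)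
    (hcomm : ∀ (p : Fin 3 → ℂ × ℂ → ℂ) (K : ℂ × ℂ → ℂ), W.IsRootBranches p z →
      RootBranches.IsIntegratingFactor p K z →
      ∀ t : ℂ, VectorField.lieBracket ℂ (RootBranches.idemField p K 0)
        (RootBranches.idemField p K 1) (t, z) = 0) :
    -fderiv ℂ W.B z (0, 1) + W.B z * (fderiv ℂ κ z (0, 1) / κ z) + fderiv ℂ W.A z (1, 0)
        - W.A z * (fderiv ℂ κ z (1, 0) / κ z) = 0 ∧
      -fderiv ℂ W.A z (0, 1) + W.A z * (fderiv ℂ κ z (0, 1) / κ z) - fderiv ℂ W.S z (1, 0)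
        + W.S z * (fderiv ℂ κ z (1, 0) / κ z) = 0 ∧
      fderiv ℂ W.S z (0, 1) - W.S z * (fderiv ℂ κ z (0, 1) / κ z)
        + fderiv ℂ κ z (1, 0) / κ z = 0 := by
  obtain ⟨p, hp⟩ := exists_isRootBranches hS hA hB hD
  obtain ⟨h01, h12, h20⟩ := hp.sub_ne_zero hD
  have hpd := fun i => (hp.1 i).differentiableAt
  have hK := hp.isIntegratingFactor hκ hκ0 hκ2 hchern
  obtain ⟨eS, eA, eB⟩ := hp.eventually_vieta.self_of_nhds
  obtain ⟨eSx, eAx, eBx⟩ := hp.fderiv_vieta (1, 0)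
  obtain ⟨eSy, eAy, eBy⟩ := hp.fderiv_vieta (0, 1)
  have hγ : ∀ v, fderiv ℂ κ z v / κ z = RootBranches.chernForm p z v := by
    intro v
    rw [hK.2.2.self_of_nhds, smul_apply, smul_eq_mul]
    field_simp
  have hk : W.saSubB z ≠ 0 := by
    rw [← hκ2.self_of_nhds]; exact pow_ne_zero 2 hκ0
  have hkd : ∀ v, 2 * W.saSubB z * (fderiv ℂ κ z v / κ z) = fderiv ℂ W.saSubB z v := by
    intro v
    have h := congrArg (fun L : ℂ × ℂ →L[ℂ] ℂ => L v) (hchern.self_of_nhds p hp)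
    simp only [smul_apply, smul_eq_mul] at h
    rw [hγ, mul_comm 2, mul_assoc, h]
    field_simp
  have hw : RootBranches.wedge (RootBranches.sigma p 0 z) (RootBranches.sigma p 1 z) ≠ 0 := by
    rw [RootBranches.wedge_sigma]
    exact mul_ne_zero (mul_ne_zero h12 h20) (by rwa [← neg_sub, neg_ne_zero])
  have hγx := RootBranches.wedge_mul_chernForm_apply hw (1, 0)
  have hγy := RootBranches.wedge_mul_chernForm_apply hw (0, 1)
  rw [RootBranches.wedge_sigma, ← hγ, RootBranches.extD_sigma hpd, RootBranches.extD_sigma hpd]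
    at hγx hγy
  simp only [RootBranches.sigma_apply_fst, RootBranches.sigma_apply_snd, Fin.isValue,
    Fin.reduceAdd, zero_add] at hγx hγy
  have h10 : p 1 z - p 0 z ≠ 0 := by rwa [← neg_sub, neg_ne_zero]
  have h02 : p 0 z - p 2 z ≠ 0 := by rwa [← neg_sub, neg_ne_zero]
  obtain ⟨hα, hαd⟩ := RootBranches.fderiv_coeff_mul hpd 0 h01 h02 (1, p 1 z)
  obtain ⟨hβ, hβd⟩ := RootBranches.fderiv_coeff_mul hpd 1 h12 h10 (1, p 0 z)
  have hbr := hcomm p κ hp hK 0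
  replace hbr := congrArg Prod.fst hbr
  rw [RootBranches.lieBracket_idemField_fst hα hβ
    (RootBranches.differentiableAt_webField hpd hκ.differentiableAt 0 h01 h20)
    (RootBranches.differentiableAt_webField hpd hκ.differentiableAt 1 h12 h01)] at hbr
  simp only [RootBranches.webField, map_smul, smul_eq_mul, Prod.fst_zero, Fin.isValue,
    Fin.reduceAdd, zero_add] at hbr hαd hβd
  -- v₁(β) = v₂(α) with the common factor κ/(p₁ - p₂) removed.
  have hbr' : (p 1 z - p 2 z) * fderiv ℂ (RootBranches.coeff p 1) z (1, p 0 z) =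
      (p 2 z - p 0 z) * fderiv ℂ (RootBranches.coeff p 0) z (1, p 1 z) := by
    field_simp at hbr
    exact mul_left_cancel₀ hκ0 (by linear_combination hbr)
  simp only [Complex.fderiv_apply_one_mk (p 1 z)] at hαd hbr'
  simp only [Complex.fderiv_apply_one_mk (p 0 z)] at hβd hbr'
  refine potentiality_of_commuting eS eA eB eSx eSy eAx eAy eBx eBy h01 h12 h20 hk
    ((hkd _).trans (fderiv_saSubB hS.differentiableAt hA.differentiableAt hB.differentiableAt _))
    ((hkd _).trans (fderiv_saSubB hS.differentiableAt hA.differentiableAt hB.differentiableAt _))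
    ?_ ?_ ?_
  · linear_combination hγx
  · linear_combination hγy
  · linear_combination -(p 2 z - p 0 z) * hβd + (p 1 z - p 2 z) * hαd
      + (p 2 z - p 0 z) * (p 1 z - p 2 z) * (p 1 z - p 0 z) ^ 2 * hbr'

end CubicODE

/-! ### Algebras with constant metric and unity, and their Frobenius structure. -/

namespace FlatThreefold

/-- The first flat coordinate `t`. -/
noncomputable def coordT : ℂ × ℂ × ℂ →L[ℂ] ℂ := ContinuousLinearMap.fst ℂ ℂ (ℂ × ℂ)

/-- The second flat coordinate `x`. -/
noncomputable def coordX : ℂ × ℂ × ℂ →L[ℂ] ℂ :=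
  (ContinuousLinearMap.fst ℂ ℂ ℂ).comp (ContinuousLinearMap.snd ℂ ℂ (ℂ × ℂ))

/-- The third flat coordinate `y`. -/
noncomputable def coordY : ℂ × ℂ × ℂ →L[ℂ] ℂ :=
  (ContinuousLinearMap.snd ℂ ℂ ℂ).comp (ContinuousLinearMap.snd ℂ ℂ (ℂ × ℂ))

@[simp] theorem coordT_apply (u : ℂ × ℂ × ℂ) : coordT u = u.1 := rfl
@[simp] theorem coordX_apply (u : ℂ × ℂ × ℂ) : coordX u = u.2.1 := rfl
@[simp] theorem coordY_apply (u : ℂ × ℂ × ℂ) : coordY u = u.2.2 := rfl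

/-- The bilinear map `(u, v) ↦ f u * g v • w`. -/
noncomputable def bilin {F : Type*} [NormedAddCommGroup F] [NormedSpace ℂ F]
    (f g : ℂ × ℂ × ℂ →L[ℂ] ℂ) (w : F) : ℂ × ℂ × ℂ →L[ℂ] ℂ × ℂ × ℂ →L[ℂ] F :=
  f.smulRight (g.smulRight w)

@[simp] theorem bilin_apply {F : Type*} [NormedAddCommGroup F] [NormedSpace ℂ F]
    (f g : ℂ × ℂ × ℂ →L[ℂ] ℂ) (w : F) (u v : ℂ × ℂ × ℂ) : bilin f g w u v = f u • g v • w := rfl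

/-- The metric `dt² + 2 dx dy`. -/
noncomputable def metric : ℂ × ℂ × ℂ →L[ℂ] ℂ × ℂ × ℂ →L[ℂ] ℂ :=
  bilin coordT coordT 1 + bilin coordX coordY 1 + bilin coordY coordX 1

theorem metric_apply (u v : ℂ × ℂ × ℂ) :
    metric u v = u.1 * v.1 + u.2.1 * v.2.2 + u.2.2 * v.2.1 := by
  simp [metric]

/-- The part of the multiplication determined by the metric and the unity `∂t`. -/
noncomputable def unitPart : ℂ × ℂ × ℂ →L[ℂ] ℂ × ℂ × ℂ →L[ℂ] ℂ × ℂ × ℂ :=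
  bilin coordT coordT (1, 0, 0) + bilin coordX coordY (1, 0, 0) + bilin coordY coordX (1, 0, 0)
    + bilin coordT coordX (0, 1, 0) + bilin coordX coordT (0, 1, 0)
    + bilin coordT coordY (0, 0, 1) + bilin coordY coordT (0, 0, 1)

/-- The coefficient of `c(∂x, ∂x, ∂x)` in the multiplication. -/
noncomputable def partXXX : ℂ × ℂ × ℂ →L[ℂ] ℂ × ℂ × ℂ →L[ℂ] ℂ × ℂ × ℂ :=
  bilin coordX coordX (0, 0, 1)

/-- The coefficient of `c(∂x, ∂x, ∂y)` in the multiplication. -/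
noncomputable def partXXY : ℂ × ℂ × ℂ →L[ℂ] ℂ × ℂ × ℂ →L[ℂ] ℂ × ℂ × ℂ :=
  bilin coordX coordX (0, 1, 0) + bilin coordX coordY (0, 0, 1) + bilin coordY coordX (0, 0, 1)

/-- The coefficient of `c(∂x, ∂y, ∂y)` in the multiplication. -/
noncomputable def partXYY : ℂ × ℂ × ℂ →L[ℂ] ℂ × ℂ × ℂ →L[ℂ] ℂ × ℂ × ℂ :=
  bilin coordY coordY (0, 0, 1) + bilin coordX coordY (0, 1, 0) + bilin coordY coordX (0, 1, 0)

/-- The coefficient of `c(∂y, ∂y, ∂y)` in the multiplication. -/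
noncomputable def partYYY : ℂ × ℂ × ℂ →L[ℂ] ℂ × ℂ × ℂ →L[ℂ] ℂ × ℂ × ℂ :=
  bilin coordY coordY (0, 1, 0)

/-- The multiplication with unity `∂t`, invariant metric `metric` and structure constants
`P = c(∂x, ∂x, ∂x)`, `Q = c(∂x, ∂x, ∂y)`, `R = c(∂x, ∂y, ∂y)`, `T = c(∂y, ∂y, ∂y)`. -/
noncomputable def structMul (P Q R T : ℂ) : ℂ × ℂ × ℂ →L[ℂ] ℂ × ℂ × ℂ →L[ℂ] ℂ × ℂ × ℂ :=
  unitPart + P • partXXX + Q • partXXY + R • partXYY + T • partYYY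

theorem structMul_apply (P Q R T : ℂ) (u v : ℂ × ℂ × ℂ) :
    structMul P Q R T u v =
      (u.1 * v.1 + u.2.1 * v.2.2 + u.2.2 * v.2.1,
        u.1 * v.2.1 + u.2.1 * v.1 + Q * (u.2.1 * v.2.1) + R * (u.2.1 * v.2.2 + u.2.2 * v.2.1)
          + T * (u.2.2 * v.2.2),
        u.1 * v.2.2 + u.2.2 * v.1 + P * (u.2.1 * v.2.1) + Q * (u.2.1 * v.2.2 + u.2.2 * v.2.1)
          + R * (u.2.2 * v.2.2)) := by
  simp only [structMul, unitPart, partXXX, partXXY, partXYY, partYYY, add_apply, smul_apply,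
    bilin_apply, coordT_apply, coordX_apply, coordY_apply, Prod.smul_mk, Prod.mk_add_mk,
    smul_eq_mul, Prod.mk.injEq]
  refine ⟨?_, ?_, ?_⟩ <;> ring

/-- With a unity only products of ∂x and ∂y matter: (∂x·∂x)·∂y - ∂x·(∂x·∂y) = (PT - QR - 1)∂x, and
the exchange of x and y gives the same scalar. -/
theorem structMul_assoc {P Q R T : ℂ} (h : P * T - Q * R = 1) (u v w : ℂ × ℂ × ℂ) :
    structMul P Q R T (structMul P Q R T u v) w = structMul P Q R T u (structMul P Q R T v w) := by
  simp only [structMul_apply, Prod.mk.injEq]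
  obtain ⟨u0, u1, u2⟩ := u
  obtain ⟨v0, v1, v2⟩ := v
  obtain ⟨w0, w1, w2⟩ := w
  refine ⟨?_, ?_, ?_⟩
  · ring
  · linear_combination (u1 * v1 * w2 - u2 * v1 * w1) * h
  · linear_combination (u2 * v2 * w1 - u1 * v2 * w2) * h

/-- The multiplication is affine in the four structure constants with constant tensors as
coefficients, so its regularity and derivative reduce to theirs. -/
theorem analyticAt_and_fderiv_combination {F : Type*} [NormedAddCommGroup F] [NormedSpace ℂ F]
    {P Q R T : ℂ × ℂ → ℂ} {q : ℂ × ℂ × ℂ} (hP : AnalyticAt ℂ P q.2) (hQ : AnalyticAt ℂ Q q.2)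
    (hR : AnalyticAt ℂ R q.2) (hT : AnalyticAt ℂ T q.2) (m a b c d : F) :
    AnalyticAt ℂ (fun q : ℂ × ℂ × ℂ => m + P q.2 • a + Q q.2 • b + R q.2 • c + T q.2 • d) q ∧
    ∀ v, fderiv ℂ (fun q : ℂ × ℂ × ℂ => m + P q.2 • a + Q q.2 • b + R q.2 • c + T q.2 • d) q v =
      fderiv ℂ P q.2 v.2 • a + fderiv ℂ Q q.2 v.2 • b + fderiv ℂ R q.2 v.2 • c
        + fderiv ℂ T q.2 v.2 • d := by
  constructor
  · have hs : AnalyticAt ℂ (fun q : ℂ × ℂ × ℂ => q.2) q := analyticAt_snd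
    exact (((analyticAt_const.add ((hP.fun_comp hs).smul analyticAt_const)).add
      ((hQ.fun_comp hs).smul analyticAt_const)).add ((hR.fun_comp hs).smul analyticAt_const)).add
      ((hT.fun_comp hs).smul analyticAt_const)
  · intro v
    have hs : HasFDerivAt (fun q : ℂ × ℂ × ℂ => q.2) (ContinuousLinearMap.snd ℂ ℂ (ℂ × ℂ)) q :=
      hasFDerivAt_snd
    have h := (((((hasFDerivAt_const m q).fun_add
      ((hP.differentiableAt.hasFDerivAt.comp q hs).smul_const a)).fun_add
      ((hQ.differentiableAt.hasFDerivAt.comp q hs).smul_const b)).fun_add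
      ((hR.differentiableAt.hasFDerivAt.comp q hs).smul_const c)).fun_add
      ((hT.differentiableAt.hasFDerivAt.comp q hs).smul_const d))
    simp only [Function.comp_apply] at h
    rw [h.fderiv]
    simp

theorem analyticAt_structMul {P Q R T : ℂ × ℂ → ℂ} {q : ℂ × ℂ × ℂ} (hP : AnalyticAt ℂ P q.2)
    (hQ : AnalyticAt ℂ Q q.2) (hR : AnalyticAt ℂ R q.2) (hT : AnalyticAt ℂ T q.2) :
    AnalyticAt ℂ (fun q : ℂ × ℂ × ℂ => structMul (P q.2) (Q q.2) (R q.2) (T q.2)) q :=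
  (analyticAt_and_fderiv_combination hP hQ hR hT unitPart partXXX partXXY partXYY partYYY).1

theorem fderiv_structMul {P Q R T : ℂ × ℂ → ℂ} {q : ℂ × ℂ × ℂ} (hP : AnalyticAt ℂ P q.2)
    (hQ : AnalyticAt ℂ Q q.2) (hR : AnalyticAt ℂ R q.2) (hT : AnalyticAt ℂ T q.2)
    (v : ℂ × ℂ × ℂ) :
    fderiv ℂ (fun q : ℂ × ℂ × ℂ => structMul (P q.2) (Q q.2) (R q.2) (T q.2)) q v =
      fderiv ℂ P q.2 v.2 • partXXX + fderiv ℂ Q q.2 v.2 • partXXY + fderiv ℂ R q.2 v.2 • partXYY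
        + fderiv ℂ T q.2 v.2 • partYYY :=
  (analyticAt_and_fderiv_combination hP hQ hR hT unitPart partXXX partXXY partXYY partYYY).2 v

/-- The Euler field `(w_x + w_y)/2 t ∂t + w_x x ∂x + w_y y ∂y` as a linear map. -/
noncomputable def eulerMap (wx wy : ℂ) : ℂ × ℂ × ℂ →L[ℂ] ℂ × ℂ × ℂ :=
  (((wx + wy) / 2) • coordT).prod ((wx • coordX).prod (wy • coordY))

theorem eulerMap_apply (wx wy : ℂ) (u : ℂ × ℂ × ℂ) :
    eulerMap wx wy u = ((wx + wy) / 2 * u.1, wx * u.2.1, wy * u.2.2) := rfl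

theorem fderiv_eulerMap (wx wy : ℂ) (q : ℂ × ℂ × ℂ) :
    fderiv ℂ (fun q => eulerMap wx wy q) q = eulerMap wx wy :=
  (eulerMap wx wy).fderiv

/-- The Frobenius structure with metric `dt² + 2 dx dy`, unity `∂t` and structure constants
`P, Q, R, T` depending on `(x, y)` only. -/
noncomputable def frobeniusStructure {U : Set (ℂ × ℂ)} {P Q R T : ℂ × ℂ → ℂ} (wx wy : ℂ) (hU : IsOpen U)
    (hP : AnalyticOnNhd ℂ P U) (hQ : AnalyticOnNhd ℂ Q U) (hR : AnalyticOnNhd ℂ R U)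
    (hT : AnalyticOnNhd ℂ T U) (hassoc : ∀ z ∈ U, P z * T z - Q z * R z = 1)
    (hPQ : ∀ z ∈ U, fderiv ℂ P z (0, 1) = fderiv ℂ Q z (1, 0))
    (hQR : ∀ z ∈ U, fderiv ℂ Q z (0, 1) = fderiv ℂ R z (1, 0))
    (hRT : ∀ z ∈ U, fderiv ℂ R z (0, 1) = fderiv ℂ T z (1, 0))
    (hXP : ∀ z ∈ U, fderiv ℂ P z (dilatation wx wy z) = 3 / 2 * (wy - wx) * P z)
    (hXQ : ∀ z ∈ U, fderiv ℂ Q z (dilatation wx wy z) = 1 / 2 * (wy - wx) * Q z)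
    (hXR : ∀ z ∈ U, fderiv ℂ R z (dilatation wx wy z) = -(1 / 2) * (wy - wx) * R z)
    (hXT : ∀ z ∈ U, fderiv ℂ T z (dilatation wx wy z) = -(3 / 2) * (wy - wx) * T z) :
    FrobeniusStructure (Set.univ ×ˢ U : Set (ℂ × ℂ × ℂ)) where
  g := fun _ => metric
  mul := fun q => structMul (P q.2) (Q q.2) (R q.2) (T q.2)
  e := fun _ => (1, 0, 0)
  E := fun q => eulerMap wx wy q
  conn := fun _ => 0
  isOpen := isOpen_univ.prod hU
  g_analytic := analyticOnNhd_const
  mul_analytic := fun q hq => analyticAt_structMul (hP _ hq.2) (hQ _ hq.2) (hR _ hq.2) (hT _ hq.2)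
  e_analytic := analyticOnNhd_const
  E_analytic := fun q _ => (eulerMap wx wy).analyticAt q
  conn_analytic := analyticOnNhd_const
  mul_comm := fun p _ u v => by
    simp only [structMul_apply, Prod.mk.injEq]
    refine ⟨?_, ?_, ?_⟩ <;> ring
  mul_assoc := fun p hp u v w => structMul_assoc (hassoc _ hp.2) u v w
  g_symm := fun p _ u v => by simp only [metric_apply]; ring
  g_nondeg := fun p _ u h => by
    have h1 := h (1, 0, 0)
    have h2 := h (0, 1, 0)
    have h3 := h (0, 0, 1)
    simp only [metric_apply, mul_zero, mul_one, add_zero, zero_add] at h1 h2 h3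
    ext <;> assumption
  g_invariant := fun p _ u v w => by
    simp only [metric_apply, structMul_apply]; ring
  conn_symm := fun p _ u v => rfl
  conn_metric := fun p _ u v w => by simp
  flat := fun p _ u v w => by simp
  one_mul := fun p _ v => by simp [structMul_apply]
  e_parallel := fun p _ u => by simp
  E_linear := fun p _ u v => by
    simp only [fderiv_eulerMap]
    simp
  -- Both dt² and dx dy have weight w_x + w_y; this is why t has weight (w_x + w_y)/2.
  E_metric := ⟨wx + wy, fun p _ u v => by
    rw [fderiv_eulerMap]
    simp only [fderiv_fun_const, metric_apply, eulerMap_apply, Pi.zero_apply,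
      zero_apply]
    ring⟩
  -- The constant is read off from ∂t·∂t = ∂t. It then dictates the weights of P, Q, R, T: the
  -- ∂y-component of ∂x·∂x gives XP = 3/2 (w_y - w_x)P.
  E_mul := ⟨(wx + wy) / 2, fun p hp u v => by
    have e : (eulerMap wx wy p).2 = dilatation wx wy p.2 := rfl
    rw [fderiv_structMul (hP _ hp.2) (hQ _ hp.2) (hR _ hp.2) (hT _ hp.2), fderiv_eulerMap, e,
      hXP _ hp.2, hXQ _ hp.2, hXR _ hp.2, hXT _ hp.2]
    simp only [structMul_apply, eulerMap_apply, partXXX, partXXY, partXYY, partYYY, add_apply,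
      smul_apply, bilin_apply, coordX_apply, coordY_apply, Prod.smul_mk,
      Prod.mk_add_mk, Prod.mk_sub_mk, smul_eq_mul, Prod.mk.injEq]
    refine ⟨?_, ?_, ?_⟩ <;> ring⟩
  potential := fun p hp z u v w => by
    have key : ∀ u z : ℂ × ℂ × ℂ, fderiv ℂ (fun q : ℂ × ℂ × ℂ =>
        metric (structMul (P q.2) (Q q.2) (R q.2) (T q.2) u v) w) p z = metric
        ((fderiv ℂ P p.2 z.2 • partXXX + fderiv ℂ Q p.2 z.2 • partXXY
          + fderiv ℂ R p.2 z.2 • partXYY + fderiv ℂ T p.2 z.2 • partYYY) u v) w := by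
      intro u z
      rw [← fderiv_structMul (hP _ hp.2) (hQ _ hp.2) (hR _ hp.2) (hT _ hp.2)]
      let L := (metric.flip w).comp ((ContinuousLinearMap.apply ℂ (ℂ × ℂ × ℂ) v).comp
        (ContinuousLinearMap.apply ℂ (ℂ × ℂ × ℂ →L[ℂ] ℂ × ℂ × ℂ) u))
      have h := L.hasFDerivAt.comp p (analyticAt_structMul (hP _ hp.2) (hQ _ hp.2) (hR _ hp.2)
        (hT _ hp.2)).differentiableAt.hasFDerivAt
      have h' : HasFDerivAt (fun q : ℂ × ℂ × ℂ =>
        metric (structMul (P q.2) (Q q.2) (R q.2) (T q.2) u v) w) _ p := h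
      rw [h'.fderiv]
      rfl
    -- In partial derivatives, the symmetry in z and u reduces to P_y = Q_x, Q_y = R_x, R_y = T_x.
    have split : ∀ (f : ℂ × ℂ → ℂ) (r : ℂ × ℂ),
        fderiv ℂ f p.2 r = r.1 * fderiv ℂ f p.2 (1, 0) + r.2 * fderiv ℂ f p.2 (0, 1) := by
      intro f r
      rw [← smul_eq_mul, ← smul_eq_mul, ← map_smul, ← map_smul, ← map_add]
      simp
    rw [key u z, key z u]
    simp only [split _ z.2, split _ u.2, hPQ _ hp.2, hQR _ hp.2, hRT _ hp.2, metric_apply,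
      partXXX, partXXY, partXYY, partYYY, add_apply, smul_apply, zero_apply, bilin_apply,
      coordX_apply, coordY_apply, Prod.smul_mk, Prod.mk_add_mk, smul_eq_mul]
    simp only [map_zero, zero_apply, Prod.fst_zero, Prod.snd_zero]
    ring

end FlatThreefold

/-! ### Continuation across the discriminant, square roots, homogeneity. -/

/-- An analytic function that does not vanish identically is nonzero on a dense set, so that an
identity between continuous functions need only be checked there. -/
theorem AnalyticOnNhd.eq_zero_of_forall_ne_zero {E F : Type*} [NormedAddCommGroup E]
    [NormedSpace ℂ E] [TopologicalSpace F] [T1Space F] [Zero F] {U : Set E} {D : E → ℂ} {f : E → F}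
    {q z : E} (hD : AnalyticOnNhd ℂ D U) (hU : IsOpen U) (hU' : IsPreconnected U) (hq : q ∈ U)
    (hne : ∃ᶠ z in 𝓝 q, D z ≠ 0) (hf : ContinuousOn f U) (h : ∀ z ∈ U, D z ≠ 0 → f z = 0)
    (hz : z ∈ U) : f z = 0 := by
  by_contra hfz
  -- If f z ≠ 0, then f ≠ 0 near z and D vanishes there, hence on all of U by the identity theorem,
  -- against `hne`.
  have h1 : ∀ᶠ w in 𝓝 z, D w = 0 := by
    filter_upwards [(hf.continuousAt (hU.mem_nhds hz)).eventually_ne hfz, hU.mem_nhds hz]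
      with w hw hwU
    by_contra hDw
    exact hw (h w hwU hDw)
  have h2 := hD.eqOn_zero_of_preconnected_of_eventuallyEq_zero hU' hz h1
  refine hne ?_
  filter_upwards [hU.mem_nhds hq] with w hw
  simpa using h2 hw

/-- Local analytic square roots. -/
theorem AnalyticAt.exists_sq_eq {E : Type*} [NormedAddCommGroup E] [NormedSpace ℂ E] {k : E → ℂ}
    {q : E} (hk : AnalyticAt ℂ k q) (h0 : k q ≠ 0) :
    ∃ κ : E → ℂ, AnalyticAt ℂ κ q ∧ ∀ᶠ z in 𝓝 q, κ z ^ 2 = k z := by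
  obtain ⟨c, hc⟩ := IsAlgClosed.exists_pow_nat_eq (k q) two_pos
  -- The quotient k/k(q) equals 1 at q, where the principal logarithm is analytic.
  refine ⟨fun z => c * Complex.exp (Complex.log (k z * (k q)⁻¹) * 2⁻¹), ?_, ?_⟩
  · refine analyticAt_const.mul ((AnalyticAt.clog (hk.mul analyticAt_const) ?_).mul
      analyticAt_const).cexp
    simp [h0]
  · filter_upwards [hk.continuousAt.eventually_ne h0] with z hz
    rw [mul_pow, ← Complex.exp_nat_mul, hc]
    have h2 : ((2 : ℕ) : ℂ) * (Complex.log (k z * (k q)⁻¹) * 2⁻¹)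
        = Complex.log (k z * (k q)⁻¹) := by
      push_cast; ring
    rw [h2, Complex.exp_log (mul_ne_zero hz (inv_ne_zero h0))]
    field_simp

theorem fderiv_div_apply {E : Type*} [NormedAddCommGroup E] [NormedSpace ℂ E] {f κ : E → ℂ} {z : E}
    (hf : DifferentiableAt ℂ f z) (hκ : DifferentiableAt ℂ κ z) (h0 : κ z ≠ 0) (v : E) :
    fderiv ℂ (fun w => f w / κ w) z v =
      (fderiv ℂ f z v - f z * (fderiv ℂ κ z v / κ z)) / κ z := by
  have h := hf.hasFDerivAt.fun_mul ((hasDerivAt_inv h0).comp_hasFDerivAt z hκ.hasFDerivAt)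
  have h' : HasFDerivAt (fun w => f w / κ w) _ z := h
  rw [h'.fderiv]
  simp
  field_simp
  ring

namespace CubicODE

variable {W : CubicODE}

theorem fderiv_form {z : ℂ × ℂ} (hS : DifferentiableAt ℂ W.S z) (hA : DifferentiableAt ℂ W.A z)
    (hB : DifferentiableAt ℂ W.B z) (u v w : ℂ × ℂ) :
    fderiv ℂ (fun r : (ℂ × ℂ) × (ℂ × ℂ) => W.form r.1 r.2) (z, u) (v, w) =
      3 * u.2 ^ 2 * w.2
        + (fderiv ℂ W.S z v * u.2 ^ 2 * u.1 + W.S z * (2 * u.2 * w.2 * u.1 + u.2 ^ 2 * w.1))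
        + (fderiv ℂ W.A z v * u.2 * u.1 ^ 2 + W.A z * (w.2 * u.1 ^ 2 + u.2 * (2 * u.1 * w.1)))
        + (fderiv ℂ W.B z v * u.1 ^ 3 + W.B z * (3 * u.1 ^ 2 * w.1)) := by
  have h1 : HasFDerivAt (fun r : (ℂ × ℂ) × (ℂ × ℂ) => r.1)
      (ContinuousLinearMap.fst ℂ (ℂ × ℂ) (ℂ × ℂ)) (z, u) := hasFDerivAt_fst
  have h2 : HasFDerivAt (fun r : (ℂ × ℂ) × (ℂ × ℂ) => r.2)
      (ContinuousLinearMap.snd ℂ (ℂ × ℂ) (ℂ × ℂ)) (z, u) := hasFDerivAt_snd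
  have hx : HasFDerivAt (fun r : (ℂ × ℂ) × (ℂ × ℂ) => r.2.1) _ (z, u) :=
    hasFDerivAt_fst.comp (z, u) h2
  have hy : HasFDerivAt (fun r : (ℂ × ℂ) × (ℂ × ℂ) => r.2.2) _ (z, u) :=
    hasFDerivAt_snd.comp (z, u) h2
  have dS : HasFDerivAt (fun r : (ℂ × ℂ) × (ℂ × ℂ) => W.S r.1) _ (z, u) :=
    HasFDerivAt.comp (z, u) (g := W.S) hS.hasFDerivAt h1
  have dA : HasFDerivAt (fun r : (ℂ × ℂ) × (ℂ × ℂ) => W.A r.1) _ (z, u) :=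
    HasFDerivAt.comp (z, u) (g := W.A) hA.hasFDerivAt h1
  have dB : HasFDerivAt (fun r : (ℂ × ℂ) × (ℂ × ℂ) => W.B r.1) _ (z, u) :=
    HasFDerivAt.comp (z, u) (g := W.B) hB.hasFDerivAt h1
  have h := (((hy.pow 3).fun_add ((dS.fun_mul (hy.pow 2)).fun_mul hx)).fun_add
    ((dA.fun_mul hy).fun_mul (hx.pow 2))).fun_add (dB.fun_mul (hx.pow 3))
  have h' : HasFDerivAt (fun r : (ℂ × ℂ) × (ℂ × ℂ) => W.form r.1 r.2) _ (z, u) := h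
  rw [h'.fderiv]
  simp
  ring

theorem fderiv_dilatation (wx wy : ℂ) (z u : ℂ × ℂ) :
    fderiv ℂ (dilatation wx wy) z u = dilatation wx wy u := by
  let L : ℂ × ℂ →L[ℂ] ℂ × ℂ :=
    (wx • ContinuousLinearMap.fst ℂ ℂ ℂ).prod (wy • ContinuousLinearMap.snd ℂ ℂ ℂ)
  have h : HasFDerivAt (dilatation wx wy) L z := L.hasFDerivAt
  rw [h.fderiv]
  rfl

/-- The coefficients of a cubic with a dilatation symmetry are homogeneous. -/
theorem homogeneous_of_symmetry {z : ℂ × ℂ} {wx wy c : ℂ} (hS : DifferentiableAt ℂ W.S z)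
    (hA : DifferentiableAt ℂ W.A z) (hB : DifferentiableAt ℂ W.B z)
    (h : ∀ u : ℂ × ℂ, fderiv ℂ (fun r : (ℂ × ℂ) × (ℂ × ℂ) => W.form r.1 r.2) (z, u)
      (dilatation wx wy z, fderiv ℂ (dilatation wx wy) z u) = c * W.form z u) :
    fderiv ℂ W.S z (dilatation wx wy z) = (wy - wx) * W.S z ∧
    fderiv ℂ W.A z (dilatation wx wy z) = 2 * (wy - wx) * W.A z ∧
    fderiv ℂ W.B z (dilatation wx wy z) = 3 * (wy - wx) * W.B z := by
  -- The vector (0, 1) determines c = 3w_y, (1, 0) isolates B, and the even and odd parts over (1,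
  -- ±1) separate S from A.
  have h0 := h (0, 1)
  have h1 := h (1, 0)
  have h2 := h (1, 1)
  have h3 := h (1, -1)
  simp only [fderiv_dilatation, fderiv_form hS hA hB] at h0 h1 h2 h3
  simp only [form, dilatation] at h0 h1 h2 h3 ⊢
  have hc : c = 3 * wy := by linear_combination -h0
  subst hc
  refine ⟨?_, ?_, ?_⟩
  · linear_combination (h2 + h3) / 2 - h1
  · linear_combination (h2 - h3) / 2
  · linear_combination h1

end CubicODE

/-! ### Idempotents and booklet directions. -/

namespace FlatThreefold

/-- The idempotent in the plane spanned by `∂t` and `∂x + a ∂y`, where `a, b, c` are the roots of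
the cubic and `κ² = SA - B`. -/
noncomputable def idempotent (κ a b c : ℂ) : ℂ × ℂ × ℂ :=
  ((a + b) * (a + c) / ((a - b) * (a - c)), κ / ((a - b) * (a - c)),
    κ / ((a - b) * (a - c)) * a)

theorem idempotent_swap (κ a b c : ℂ) : idempotent κ a b c = idempotent κ a c b := by
  rw [idempotent, idempotent, mul_comm (a - b), mul_comm (a + b)]

variable {κ a b c S A B : ℂ}

/-- These vectors are the values of the fields eᵢ for K = -κ. Only the ∂t-component uses κ² = SA - B
= -(a + b)(b + c)(c + a); the others are identities in the roots. -/
theorem structMul_idempotent_self (hκ : κ ≠ 0) (hS : S = -(a + b + c))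
    (hA : A = a * b + a * c + b * c) (hB : B = -(a * b * c)) (hκ2 : κ ^ 2 = S * A - B)
    (hab : a - b ≠ 0) (hac : a - c ≠ 0) :
    structMul (-B / κ) (-A / κ) (S / κ) (1 / κ) (idempotent κ a b c) (idempotent κ a b c) =
      idempotent κ a b c := by
  subst hS hA hB
  simp only [structMul_apply, idempotent, Prod.mk.injEq]
  refine ⟨?_, ?_, ?_⟩
  · field_simp
    linear_combination 2 * a * hκ2
  · field_simp
    ring
  · field_simp
    ring

theorem structMul_idempotent_ne (hS : S = -(a + b + c))
    (hA : A = a * b + a * c + b * c) (hB : B = -(a * b * c)) (hκ2 : κ ^ 2 = S * A - B)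
    (hab : a - b ≠ 0) (hac : a - c ≠ 0) (hbc : b - c ≠ 0) :
    structMul (-B / κ) (-A / κ) (S / κ) (1 / κ) (idempotent κ a b c) (idempotent κ b a c) = 0 := by
  have hba : b - a ≠ 0 := by rwa [← neg_sub, neg_ne_zero]
  subst hS hA hB
  simp only [structMul_apply, idempotent, Prod.mk_eq_zero]
  refine ⟨?_, ?_, ?_⟩
  · field_simp
    linear_combination (a + b) * hκ2
  · field_simp
    ring
  · field_simp
    ring

theorem idempotent_ne_zero (hκ : κ ≠ 0) (hab : a - b ≠ 0) (hac : a - c ≠ 0) :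
    idempotent κ a b c ≠ 0 := by
  intro h
  have h1 := congrArg (fun v : ℂ × ℂ × ℂ => v.2.1) h
  exact div_ne_zero hκ (mul_ne_zero hab hac) h1

end FlatThreefold

namespace FrobeniusStructure

variable {M : Set (ℂ × ℂ × ℂ)} {F : FrobeniusStructure M} {q : ℂ × ℂ × ℂ}
  {ε : Fin 3 → ℂ × ℂ × ℂ}

/-- Multiplying a linear relation by ε i isolates its i-th coefficient; three independent vectors
then span. -/
theorem isIdempotentFrame_of_mul (h0 : ∀ i, ε i ≠ 0)
    (h : ∀ i j, F.mul q (ε i) (ε j) = if i = j then ε i else 0) : F.IsIdempotentFrame q ε := by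
  have hli : LinearIndependent ℂ ε := by
    rw [Fintype.linearIndependent_iff]
    intro g hg i
    have h1 := congrArg (fun v => F.mul q v (ε i)) hg
    simpa [map_sum, h, h0] using h1
  exact ⟨hli, hli.span_eq_top_of_card_eq_finrank (by simp), h⟩

theorem IsIdempotentFrame.ne_zero (hε : F.IsIdempotentFrame q ε) (i : Fin 3) : ε i ≠ 0 :=
  hε.1.ne_zero i

/-- The coordinates of v in the frame are the eigenvalues of multiplication by v. -/
theorem IsIdempotentFrame.exists_sum (hε : F.IsIdempotentFrame q ε) (v : ℂ × ℂ × ℂ) :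
    ∃ c : Fin 3 → ℂ, v = ∑ i, c i • ε i ∧ ∀ i, F.mul q v (ε i) = c i • ε i := by
  have hv : v ∈ Submodule.span ℂ (Set.range ε) := by rw [hε.2.1]; trivial
  obtain ⟨c, hc⟩ := (Submodule.mem_span_range_iff_exists_fun ℂ).1 hv
  refine ⟨c, hc.symm, fun i => ?_⟩
  rw [← hc]
  simp [map_sum, hε.2.2]

theorem IsIdempotentFrame.sum_eq (hε : F.IsIdempotentFrame q ε) (hq : q ∈ M) :
    F.e q = ε 0 + ε 1 + ε 2 := by
  obtain ⟨d, hd, hd'⟩ := hε.exists_sum (F.e q)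
  have h1 : ∀ i, d i = 1 := fun i => by
    have h := hd' i
    rw [F.one_mul q hq] at h
    exact smul_left_injective ℂ (hε.ne_zero i) (by simpa using h.symm)
  rw [hd]
  simp [Fin.sum_univ_three, h1]

/-- A vector whose square depends linearly on the unity and the vector lies in a plane spanned by
the unity and an idempotent. -/
theorem IsIdempotentFrame.exists_mem_span (hε : F.IsIdempotentFrame q ε) (hq : q ∈ M)
    {v : ℂ × ℂ × ℂ} {r s : ℂ} (hv : F.mul q v v = r • F.e q + s • v) :
    ∃ i, v ∈ Submodule.span ℂ {F.e q, ε i} := by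
  obtain ⟨c, hc, hc'⟩ := hε.exists_sum v
  -- The three eigenvalues satisfy one quadratic equation, so two of them coincide, and v is that
  -- common value times the unity plus a multiple of the remaining idempotent.
  have hquad : ∀ i, c i * c i = r + s * c i := fun i => by
    have h := congrArg (fun w => F.mul q w (ε i)) hv
    simp only [F.mul_assoc q hq, map_add, map_smul, add_apply, smul_apply, hc',
      F.one_mul q hq, smul_smul, ← add_smul] at h
    exact smul_left_injective ℂ (hε.ne_zero i) h
  have hpair : ∀ i j, c i = c j ∨ c i + c j = s := fun i j => by
    have h : (c i - c j) * (c i + c j - s) = 0 := by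
      linear_combination hquad i - hquad j
    rcases mul_eq_zero.1 h with h | h
    · exact Or.inl (sub_eq_zero.1 h)
    · exact Or.inr (sub_eq_zero.1 h)
  rw [Fin.sum_univ_three] at hc
  have hcases : c 1 = c 2 ∨ c 0 = c 2 ∨ c 0 = c 1 := by
    rcases hpair 0 1 with h | h
    · exact Or.inr (Or.inr h)
    · rcases hpair 0 2 with h' | h'
      · exact Or.inr (Or.inl h')
      · exact Or.inl (by linear_combination h - h')
  rw [hε.sum_eq hq]
  simp only [Submodule.mem_span_pair]
  rcases hcases with h | h | h
  · exact ⟨0, c 1, c 0 - c 1, by rw [hc, ← h]; module⟩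
  · exact ⟨1, c 0, c 1 - c 0, by rw [hc, ← h]; module⟩
  · exact ⟨2, c 0, c 2 - c 0, by rw [hc, ← h]; module⟩

/-- The square of a vector in the plane spanned by the unity and an idempotent. -/
theorem IsIdempotentFrame.exists_sq_of_mem_span (hε : F.IsIdempotentFrame q ε) (hq : q ∈ M)
    {v : ℂ × ℂ × ℂ} {i : Fin 3} (hv : v ∈ Submodule.span ℂ {F.e q, ε i}) :
    ∃ a b r s : ℂ, v = a • F.e q + b • ε i ∧ F.mul q v v = r • F.e q + s • ε i := by
  obtain ⟨a, b, rfl⟩ := Submodule.mem_span_pair.1 hv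
  refine ⟨a, b, a * a, 2 * a * b + b * b, rfl, ?_⟩
  have h1 : F.mul q (ε i) (F.e q) = ε i := by rw [F.mul_comm q hq, F.one_mul q hq]
  simp only [map_add, map_smul, add_apply, smul_apply, F.one_mul q hq, h1, hε.2.2, if_true]
  module

end FrobeniusStructure

namespace CubicODE

variable {W : CubicODE}

/-- The tangent algebra built from the cubic is semi-simple off the discriminant curve. -/
theorem isSemisimpleAt_of_discr_ne_zero {M : Set (ℂ × ℂ × ℂ)} {F : FrobeniusStructure M}
    {q : ℂ × ℂ × ℂ} {z : ℂ × ℂ} {κ : ℂ} (hκ : κ ≠ 0) (hκ2 : κ ^ 2 = W.saSubB z)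
    (hmul : F.mul q = FlatThreefold.structMul (-W.B z / κ) (-W.A z / κ) (W.S z / κ) (1 / κ))
    (hD : W.discr z ≠ 0) : F.IsSemisimpleAt q := by
  obtain ⟨a, b, c, hS, hA, hB⟩ := exists_three_roots (W.S z) (W.A z) (W.B z)
  have hV : W.discr z = ((a - b) * (a - c) * (b - c)) ^ 2 := by
    rw [discr, hS, hA, hB]; ring
  have hV' : (a - b) * (a - c) * (b - c) ≠ 0 := fun h => hD (by rw [hV, h]; ring)
  simp only [mul_ne_zero_iff] at hV'
  obtain ⟨⟨hab, hac⟩, hbc⟩ := hV'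
  have hba : b - a ≠ 0 := by rwa [← neg_sub, neg_ne_zero]
  have hca : c - a ≠ 0 := by rwa [← neg_sub, neg_ne_zero]
  have hcb : c - b ≠ 0 := by rwa [← neg_sub, neg_ne_zero]
  have self : ∀ r s t : ℂ, W.S z = -(r + s + t) → W.A z = r * s + r * t + s * t →
      W.B z = -(r * s * t) → r - s ≠ 0 → r - t ≠ 0 →
      F.mul q (FlatThreefold.idempotent κ r s t) (FlatThreefold.idempotent κ r s t) =
        FlatThreefold.idempotent κ r s t := fun r s t h1 h2 h3 h4 h5 => by
    rw [hmul]; exact FlatThreefold.structMul_idempotent_self hκ h1 h2 h3 hκ2 h4 h5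
  have orth : ∀ r s t : ℂ, W.S z = -(r + s + t) → W.A z = r * s + r * t + s * t →
      W.B z = -(r * s * t) → r - s ≠ 0 → r - t ≠ 0 → s - t ≠ 0 →
      F.mul q (FlatThreefold.idempotent κ r s t) (FlatThreefold.idempotent κ s r t) = 0 :=
    fun r s t h1 h2 h3 h4 h5 h6 => by
      rw [hmul]; exact FlatThreefold.structMul_idempotent_ne h1 h2 h3 hκ2 h4 h5 h6
  have m00 := self a b c hS hA hB hab hac
  have m11 := self b a c (by rw [hS]; ring) (by rw [hA]; ring) (by rw [hB]; ring) hba hbc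
  have m22 := self c a b (by rw [hS]; ring) (by rw [hA]; ring) (by rw [hB]; ring) hca hcb
  have m01 := orth a b c hS hA hB hab hac hbc
  have m10 := orth b a c (by rw [hS]; ring) (by rw [hA]; ring) (by rw [hB]; ring) hba hbc hac
  have m02 := orth a c b (by rw [hS]; ring) (by rw [hA]; ring) (by rw [hB]; ring) hac hab hcb
  have m20 := orth c a b (by rw [hS]; ring) (by rw [hA]; ring) (by rw [hB]; ring) hca hcb hab
  have m12 := orth b c a (by rw [hS]; ring) (by rw [hA]; ring) (by rw [hB]; ring) hbc hba hca
  have m21 := orth c b a (by rw [hS]; ring) (by rw [hA]; ring) (by rw [hB]; ring) hcb hca hba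
  rw [FlatThreefold.idempotent_swap κ a c b] at m02
  rw [FlatThreefold.idempotent_swap κ a c b] at m20
  rw [FlatThreefold.idempotent_swap κ b c a, FlatThreefold.idempotent_swap κ c b a] at m12 m21
  refine ⟨![FlatThreefold.idempotent κ a b c, FlatThreefold.idempotent κ b a c,
    FlatThreefold.idempotent κ c a b], FrobeniusStructure.isIdempotentFrame_of_mul ?_ ?_⟩
  · intro i
    fin_cases i
    exacts [FlatThreefold.idempotent_ne_zero hκ hab hac,
      FlatThreefold.idempotent_ne_zero hκ hba hbc, FlatThreefold.idempotent_ne_zero hκ hca hcb]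
  · intro i j
    fin_cases i <;> fin_cases j
    exacts [m00, m01, m02, m10, m11, m12, m20, m21, m22]

/-- Where the tangent algebra is semi-simple, the booklet directions are the zeros of the cubic
form. -/
theorem isBookletDirection_iff {M : Set (ℂ × ℂ × ℂ)} {F : FrobeniusStructure M} {z u : ℂ × ℂ}
    {κ : ℂ} (hκ : κ ≠ 0) (hz : (0, z) ∈ M) (he : F.e (0, z) = (1, 0, 0))
    (hmul : F.mul (0, z) =
      FlatThreefold.structMul (-W.B z / κ) (-W.A z / κ) (W.S z / κ) (1 / κ))
    (hss : F.IsSemisimpleAt (0, z)) (hu : u ≠ 0) :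
    F.IsBookletDirection (fun z => (0, z)) z u ↔ W.form z u = 0 := by
  have hφ : fderiv ℂ (fun z : ℂ × ℂ => ((0 : ℂ), z)) z u = (0, u) := by
    have h : HasFDerivAt (fun z : ℂ × ℂ => ((0 : ℂ), z)) _ z :=
      (ContinuousLinearMap.inr ℂ ℂ (ℂ × ℂ)).hasFDerivAt
    rw [h.fderiv]
    rfl
  obtain ⟨x, y⟩ := u
  rw [FrobeniusStructure.IsBookletDirection, hφ]
  set X := -W.A z / κ * (x * x) + W.S z / κ * (x * y + y * x) + 1 / κ * (y * y) with hX
  set Y := -W.B z / κ * (x * x) + -W.A z / κ * (x * y + y * x) + W.S z / κ * (y * y) with hY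
  have hsq : F.mul (0, z) (0, x, y) (0, x, y) = (x * y + y * x, X, Y) := by
    rw [hmul, FlatThreefold.structMul_apply]
    simp [X, Y]
  -- The cubic form measures whether the (∂x, ∂y)-part of u² is proportional to u.
  have hform : W.form z (x, y) = κ * (y * X - x * Y) := by
    simp only [form, hX, hY]
    field_simp
    ring
  rw [hform, mul_eq_zero, or_iff_right hκ]
  constructor
  · rintro ⟨-, ε, hε, i, hi⟩
    obtain ⟨a, b, r, s, h1, h2⟩ := hε.exists_sq_of_mem_span hz hi
    rw [hsq, he] at h2
    rw [he] at h1
    have hx := congrArg (fun v : ℂ × ℂ × ℂ => v.2.1) h1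
    have hy := congrArg (fun v : ℂ × ℂ × ℂ => v.2.2) h1
    have hX' := congrArg (fun v : ℂ × ℂ × ℂ => v.2.1) h2
    have hY' := congrArg (fun v : ℂ × ℂ × ℂ => v.2.2) h2
    simp only [Prod.snd_add, Prod.fst_add, Prod.smul_snd, Prod.smul_fst, smul_eq_mul, mul_zero,
      zero_add] at hx hy hX' hY'
    rw [hX', hY', hx, hy]
    ring
  · intro h
    obtain ⟨ε, hε⟩ := hss
    refine ⟨hu, ε, hε, ?_⟩
    -- The factor s is found by dividing by whichever coordinate of u is nonzero.
    obtain ⟨s, hsX, hsY⟩ : ∃ s, X = s * x ∧ Y = s * y := by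
      by_cases hx : x = 0
      · have hy : y ≠ 0 := fun hy => hu (by rw [hx, hy]; rfl)
        refine ⟨Y / y, ?_, by field_simp⟩
        field_simp
        linear_combination h
      · refine ⟨X / x, by field_simp, ?_⟩
        field_simp
        linear_combination -h
    refine hε.exists_mem_span hz (r := x * y + y * x) (s := s) ?_
    rw [hsq, he, hsX, hsY]
    simp

end CubicODE

/-! ### Assembly of the Frobenius structure. -/

theorem mainTheorem2
    (W : CubicODE) (q₀ : ℂ × ℂ) (wx wy : ℂ)
    (hS : AnalyticAt ℂ W.S q₀) (hA : AnalyticAt ℂ W.A q₀) (hB : AnalyticAt ℂ W.B q₀)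
    (hweb : ∃ᶠ z in 𝓝 q₀, W.discr z ≠ 0)
    (hne : W.saSubB q₀ ≠ 0)
    (hw : wx ≠ wy)
    (hsymm : W.IsInfinitesimalSymmetry (dilatation wx wy) q₀)
    (hchern : ∀ᶠ z in 𝓝 q₀, W.discr z ≠ 0 →
      ∀ p : Fin 3 → ℂ × ℂ → ℂ, W.IsRootBranches p z →
        (2 : ℂ) • RootBranches.chernForm p z = (W.saSubB z)⁻¹ • fderiv ℂ W.saSubB z)
    (hcomm : ∀ᶠ z in 𝓝 q₀, W.discr z ≠ 0 →
      ∀ (p : Fin 3 → ℂ × ℂ → ℂ) (K : ℂ × ℂ → ℂ), W.IsRootBranches p z →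
        RootBranches.IsIntegratingFactor p K z →
        ∀ t : ℂ, VectorField.lieBracket ℂ (RootBranches.idemField p K 0)
          (RootBranches.idemField p K 1) (t, z) = 0) :
    ∃ (M : Set (ℂ × ℂ × ℂ)) (F : FrobeniusStructure M),
      (0, q₀) ∈ M ∧
      (∀ p ∈ M, F.g p (F.e p) (F.e p) = 1) ∧
      W.IsBookletWeb F (fun z => (0, z)) q₀ ∧
      (∀ p ∈ M, F.e p = (1, 0, 0)) ∧
      (∀ p ∈ M, ∀ u v : ℂ × ℂ × ℂ,
        F.g p u v = u.1 * v.1 + u.2.1 * v.2.2 + u.2.2 * v.2.1) ∧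
      (∀ p ∈ M, F.E p = ((wx + wy) / 2 * p.1, dilatation wx wy p.2)) := by
  have hk : AnalyticAt ℂ W.saSubB q₀ := (hS.mul hA).sub hB
  obtain ⟨κ, hκ, hκ2⟩ := hk.exists_sq_eq hne
  have hκ0 : κ q₀ ≠ 0 := fun h => hne (by rw [← hκ2.self_of_nhds, h]; ring)
  obtain ⟨c, hc⟩ := hsymm
  -- All local hypotheses are made to hold on one ball, whose connectedness the identity theorem
  -- needs.
  obtain ⟨r, hr, hball⟩ := Metric.eventually_nhds_iff_ball.1
    (hS.eventually_analyticAt.and (hA.eventually_analyticAt.and (hB.eventually_analyticAt.and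
      (hκ.eventually_analyticAt.and ((hκ.continuousAt.eventually_ne hκ0).and
        (hκ2.eventually_nhds.and (hchern.eventually_nhds.and (hcomm.and hc))))))))
  set U := Metric.ball q₀ r
  have hU : IsOpen U := Metric.isOpen_ball
  have hq : q₀ ∈ U := Metric.mem_ball_self hr
  have hUc : IsPreconnected U := (convex_ball q₀ r).isPreconnected
  have aS : AnalyticOnNhd ℂ W.S U := fun z hz => (hball z hz).1
  have aA : AnalyticOnNhd ℂ W.A U := fun z hz => (hball z hz).2.1
  have aB : AnalyticOnNhd ℂ W.B U := fun z hz => (hball z hz).2.2.1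
  have aκ : AnalyticOnNhd ℂ κ U := fun z hz => (hball z hz).2.2.2.1
  have nκ : ∀ z ∈ U, κ z ≠ 0 := fun z hz => (hball z hz).2.2.2.2.1
  have eκ : ∀ z ∈ U, ∀ᶠ w in 𝓝 z, κ w ^ 2 = W.saSubB w := fun z hz => (hball z hz).2.2.2.2.2.1
  have aD : AnalyticOnNhd ℂ W.discr U := fun z hz =>
    ((((((analyticAt_const.mul (aS z hz)).mul (aA z hz)).mul (aB z hz)).add
      (((aS z hz).pow 2).mul ((aA z hz).pow 2))).sub (analyticAt_const.mul ((aA z hz).pow 3))).sub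
      (analyticAt_const.mul ((aB z hz).pow 2))).sub
      ((analyticAt_const.mul (aB z hz)).mul ((aS z hz).pow 3))
  have cont : ∀ {f : ℂ × ℂ → ℂ} (v : ℂ × ℂ), AnalyticOnNhd ℂ f U →
      ContinuousOn (fun z => fderiv ℂ f z v) U := fun v hf =>
    hf.fderiv.continuousOn.clm_apply continuousOn_const
  have cκ : ∀ v, ContinuousOn (fun z => fderiv ℂ κ z v / κ z) U := fun v =>
    (cont v aκ).div aκ.continuousOn nκ
  have pot := fun z (hz : z ∈ U) (hD : W.discr z ≠ 0) =>
    CubicODE.potentiality_of_discr_ne_zero (aS z hz) (aA z hz) (aB z hz) hD (aκ z hz) (nκ z hz)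
      (eκ z hz) (by
        filter_upwards [(hball z hz).2.2.2.2.2.2.1,
          (aD z hz).continuousAt.eventually_ne hD] with w h1 h2 using h1 h2)
      ((hball z hz).2.2.2.2.2.2.2.1 hD)
  have pot1 : ∀ z ∈ U, -fderiv ℂ W.B z (0, 1) + W.B z * (fderiv ℂ κ z (0, 1) / κ z)
      + fderiv ℂ W.A z (1, 0) - W.A z * (fderiv ℂ κ z (1, 0) / κ z) = 0 := fun z hz =>
    aD.eq_zero_of_forall_ne_zero hU hUc hq hweb
    ((((cont (0, 1) aB).neg.add (aB.continuousOn.mul (cκ (0, 1)))).add (cont (1, 0) aA)).sub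
      (aA.continuousOn.mul (cκ (1, 0)))) (fun z hz hD => (pot z hz hD).1) hz
  have pot2 : ∀ z ∈ U, -fderiv ℂ W.A z (0, 1) + W.A z * (fderiv ℂ κ z (0, 1) / κ z)
      - fderiv ℂ W.S z (1, 0) + W.S z * (fderiv ℂ κ z (1, 0) / κ z) = 0 := fun z hz =>
    aD.eq_zero_of_forall_ne_zero hU hUc hq hweb
    ((((cont (0, 1) aA).neg.add (aA.continuousOn.mul (cκ (0, 1)))).sub (cont (1, 0) aS)).add
      (aS.continuousOn.mul (cκ (1, 0)))) (fun z hz hD => (pot z hz hD).2.1) hz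
  have pot3 : ∀ z ∈ U, fderiv ℂ W.S z (0, 1) - W.S z * (fderiv ℂ κ z (0, 1) / κ z)
      + fderiv ℂ κ z (1, 0) / κ z = 0 := fun z hz =>
    aD.eq_zero_of_forall_ne_zero hU hUc hq hweb
    (((cont (0, 1) aS).sub (aS.continuousOn.mul (cκ (0, 1)))).add (cκ (1, 0)))
    (fun z hz hD => (pot z hz hD).2.2) hz
  have hom := fun z (hz : z ∈ U) => CubicODE.homogeneous_of_symmetry (aS z hz).differentiableAt
    (aA z hz).differentiableAt (aB z hz).differentiableAt (hball z hz).2.2.2.2.2.2.2.2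
  -- X(κ²) = X(SA - B) = 3(w_y - w_x)κ², since SA and B both have weight 3.
  have homκ : ∀ z ∈ U, fderiv ℂ κ z (dilatation wx wy z) / κ z = 3 / 2 * (wy - wx) := by
    intro z hz
    have h1 : HasFDerivAt (fun w => κ w ^ 2) _ z := (aκ z hz).differentiableAt.hasFDerivAt.pow 2
    have h2 := (h1.congr_of_eventuallyEq ((eκ z hz).mono fun _ h => h.symm)).fderiv
    have h3 := congrArg (fun L : ℂ × ℂ →L[ℂ] ℂ => L (dilatation wx wy z)) h2
    obtain ⟨sS, sA, sB⟩ := hom z hz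
    simp only [CubicODE.fderiv_saSubB (aS z hz).differentiableAt (aA z hz).differentiableAt
      (aB z hz).differentiableAt, sS, sA, sB] at h3
    have h4 := (eκ z hz).self_of_nhds
    rw [CubicODE.saSubB] at h4
    simp at h3
    have h0 := nκ z hz
    rw [div_eq_iff h0]
    refine mul_left_cancel₀ h0 ?_
    linear_combination -h3 / 2 + 3 / 2 * (wy - wx) * (-h4)
  have dκ := fun z (hz : z ∈ U) => (aκ z hz).differentiableAt
  have key : ∀ {f : ℂ × ℂ → ℂ} {z : ℂ × ℂ} (_ : z ∈ U) (_ : AnalyticOnNhd ℂ f U) (v : ℂ × ℂ),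
      fderiv ℂ (fun w => f w / κ w) z v =
        (fderiv ℂ f z v - f z * (fderiv ℂ κ z v / κ z)) / κ z :=
    fun hz hf v => fderiv_div_apply (hf _ hz).differentiableAt (dκ _ hz) (nκ _ hz) v
  have neg : ∀ (f : ℂ × ℂ → ℂ) (z v : ℂ × ℂ), fderiv ℂ (fun w => -f w) z v = -fderiv ℂ f z v :=
    fun f z v => by rw [fderiv_fun_neg]; rfl
  have anB : AnalyticOnNhd ℂ (fun w => -W.B w) U := aB.neg
  have anA : AnalyticOnNhd ℂ (fun w => -W.A w) U := aA.neg
  have a1 : AnalyticOnNhd ℂ (fun _ : ℂ × ℂ => (1 : ℂ)) U := analyticOnNhd_const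
  refine ⟨Set.univ ×ˢ U, FlatThreefold.frobeniusStructure
    (P := fun z => -W.B z / κ z) (Q := fun z => -W.A z / κ z) (R := fun z => W.S z / κ z)
    (T := fun z => 1 / κ z) wx wy hU (anB.div aκ nκ) (anA.div aκ nκ) (aS.div aκ nκ)
    (a1.div aκ nκ) ?_ ?_ ?_ ?_ ?_ ?_ ?_ ?_, ⟨trivial, hq⟩, ?_, ?_, ?_, ?_, ?_⟩
  · intro z hz
    have h := (eκ z hz).self_of_nhds
    rw [CubicODE.saSubB] at h
    have h0 := nκ z hz
    field_simp
    linear_combination -h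
  · intro z hz
    rw [key hz anB, key hz anA, neg, neg]
    congr 1
    linear_combination pot1 z hz
  · intro z hz
    rw [key hz anA, key hz aS, neg]
    congr 1
    linear_combination pot2 z hz
  · intro z hz
    rw [key hz aS, key hz a1]
    congr 1
    simp only [fderiv_fun_const, Pi.zero_apply, zero_apply]
    linear_combination pot3 z hz
  · intro z hz
    rw [key hz anB, neg, homκ z hz, (hom z hz).2.2]
    ring
  · intro z hz
    rw [key hz anA, neg, homκ z hz, (hom z hz).2.1]
    ring
  · intro z hz
    rw [key hz aS, homκ z hz, (hom z hz).1]
    ring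
  · intro z hz
    rw [key hz a1, homκ z hz]
    simp only [fderiv_fun_const, Pi.zero_apply, zero_apply]
    ring
  · intro p _
    exact (FlatThreefold.metric_apply _ _).trans (by simp [FlatThreefold.frobeniusStructure])
  · refine ⟨analyticAt_const.prod analyticAt_id, ⟨trivial, hq⟩, ?_⟩
    filter_upwards [hU.mem_nhds hq] with z hz
    have hφ : fderiv ℂ (fun z : ℂ × ℂ => ((0 : ℂ), z)) z = ContinuousLinearMap.inr ℂ ℂ (ℂ × ℂ) :=
      (ContinuousLinearMap.inr ℂ ℂ (ℂ × ℂ)).fderiv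
    refine ⟨⟨?_, ?_⟩, fun hD => ?_, fun hss u hu => ?_⟩
    · rw [hφ]
      intro u v huv
      exact congrArg Prod.snd huv
    · rw [hφ]
      rintro ⟨u, h⟩
      exact zero_ne_one (congrArg Prod.fst h)
    · exact CubicODE.isSemisimpleAt_of_discr_ne_zero (nκ z hz) (eκ z hz).self_of_nhds rfl hD
    · exact CubicODE.isBookletDirection_iff (nκ z hz) ⟨trivial, hz⟩ rfl rfl hss hu
  · exact fun p _ => rfl
  · exact fun p _ u v => FlatThreefold.metric_apply u v
  · exact fun p _ => rfl
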